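/- Let $\lambda>0$, $\alpha>2$, $D>0$, let $\mathbf x_o\in\mathbb R^2$ and $d=\|\mathbf x_o\|\ge 0$. Let $\mathcal P$ be a homogeneous Poisson point process of intensity $\lambda$ on $\mathbb R^2$, let $\mathcal A=\mathbf b(\mathbf x_o,D)$ be the disk of radius $D$ centred at $\mathbf x_o$, and let $\Phi=\mathcal P\cap\mathcal A$ be the set of transmitters. The receiver is at the origin. The points $\mathbf y$ of $\mathcal P$ carry i.i.d. exponential fading variables $h_{\mathbf y}$ of mean $1$, independent of $\mathcal P$. On the event $\Phi\neq\emptyset$ let $\mathbf x_c$ be the point of $\Phi$ nearest to the origin, $R_c=\|\mathbf x_c\|$, and let $\mathcal I_c=\sum_{\mathbf y\in\Phi\setminus\{\mathbf x_c\}}h_{\mathbf y}\|\mathbf y\|^{-\alpha}$ be the interference. Put $$\mathcal F(s,x)=x^2\,{}_2F_1\!\left(1,\tfrac2\alpha;1+\tfrac2\alpha;-\tfrac{x^\alpha}{s}\right),$$ where ${}_2F_1$ is the (analytically continued) Gauss hypergeometric function, and $$\varphi_0=\arcsin\frac Dd,\qquad \varphi_1(r)=\arccos\frac{r^2+d^2-D^2}{2dr},$$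 $$R_1(\theta)=d\cos\theta+\sqrt{D^2-d^2\sin^2\theta},\qquad \hat R_1(\theta)=d\cos\theta-\sqrt{D^2-d^2\sin^2\theta}.$$ Theorem. Consider the law of the network conditioned on $\Phi\ne\emptyset$. For almost every value $r$ of $R_c$ (with respect to the conditional law of $R_c$) and all $s>0$, the conditional Laplace transform $\mathcal L(s\mid r)=\mathbb E[e^{-s\mathcal I_c}\mid R_c=r]$ is $$\mathcal L(s\mid r)=\begin{cases}A^d(s)&\text{if } d\le D,\ 0\le r<D-d,\\ B^d(s)&\text{if } d\le D,\ D-d\le r<D+d,\ \text{ or } d>D,\ \sqrt{d^2-D^2}\le r<d+D,\\ C^d(s)&\text{if } d>D,\ d-D\le r<\sqrt{d^2-D^2},\end{cases}$$ and almost every value $r$ falls in one of these cases, where $$A^d(s)=\exp\Bigl(\pi\lambda\mathcal F(s,r)-\lambda\int_0^{\pi}\mathcal F(s,R_1(\theta))\,d\theta\Bigr),$$ $$B^d(s)=\exp\Bigl(\varphi_1(r)\lambda\mathcal F(s,r)-\lambda\int_0^{\varphi_1(r)}\mathcal F(s,R_1(\theta))\,d\theta\Bigr),$$ $$C^d(s)=B^d(s)\exp\Bigl(-\lambda\int_{\varphi_1(r)}^{\varphi_0}\bigl\{\mathcal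 F(s,R_1(\theta))-\mathcal F(s,\hat R_1(\theta))\bigr\}\,d\theta\Bigr).$$ -/

import Mathlib

open MeasureTheory ProbabilityTheory Set

noncomputable section

namespace SingleCluster

/-! ### The Gauss hypergeometric function -/

/-- `f` is the real-analytic continuation to `(-∞, 1)` of the Gauss hypergeometric series
`∑ (a)ₙ (b)ₙ / (c)ₙ * zⁿ / n!`. There is at most one such function on `(-∞, 1)`. -/
def IsGaussContinuation (a b c : ℝ) (f : ℝ → ℝ) : Prop :=
  AnalyticOnNhd ℝ f (Iio 1) ∧ ∀ z : ℝ, |z| < 1 → f z = ordinaryHypergeometric a b c z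

/-- The Gauss hypergeometric function `₂F₁(a, b; c; z)` for real `z < 1` (principal branch).
Mathlib's `ordinaryHypergeometric` is only the sum of the series, meaningful for `|z| < 1`. -/
def gaussHypergeometric (a b c : ℝ) : ℝ → ℝ :=
  Classical.epsilon (IsGaussContinuation a b c)

/-- A lower bound for the denominator `1 - z t` in Euler's integral for `₂F₁(1, b; 1 + b; z)`. -/
theorem euler_norm_bound {z : ℂ} {δ t : ℝ} (hδ : δ ≤ 1) (hz : z.re ≤ 1 - δ)
    (ht : t ∈ Ioc (0 : ℝ) 1) : δ ≤ ‖1 - z * (t : ℂ)‖ := by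
  refine le_trans ?_ (Complex.re_le_norm _)
  have : (1 - z * (t : ℂ)).re = 1 - z.re * t := by simp
  rw [this]
  nlinarith [ht.1, ht.2, mul_le_mul_of_nonneg_right hz ht.1.le]

theorem euler_hasDerivAt {b : ℝ} (hb : 0 < b) {z : ℂ} (hz : z.re < 1) :
    DifferentiableAt ℂ (fun z : ℂ => ∫ t in Ioc (0 : ℝ) 1,
      ((t ^ (b - 1) : ℝ) : ℂ) * (1 - z * (t : ℂ))⁻¹) z := by
  obtain ⟨δ, hδ0, hδ1, hδz⟩ : ∃ δ : ℝ, 0 < δ ∧ δ ≤ 1 ∧ z.re < 1 - δ :=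
    ⟨min 1 ((1 - z.re) / 2), lt_min one_pos (by linarith), min_le_left _ _, by
      have := min_le_right 1 ((1 - z.re) / 2); linarith⟩
  have hint : IntegrableOn (fun t : ℝ => t ^ (b - 1)) (Ioc 0 1) := by
    rw [← intervalIntegrable_iff_integrableOn_Ioc_of_le zero_le_one]
    exact intervalIntegral.intervalIntegrable_rpow' (by linarith)
  have hU : {w : ℂ | w.re < 1 - δ} ∈ nhds z :=
    (isOpen_lt Complex.continuous_re continuous_const).mem_nhds hδz
  have key := hasDerivAt_integral_of_dominated_loc_of_deriv_le
    (μ := volume.restrict (Ioc (0 : ℝ) 1)) (x₀ := z)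
    (F := fun (z : ℂ) (t : ℝ) => ((t ^ (b - 1) : ℝ) : ℂ) * (1 - z * (t : ℂ))⁻¹)
    (F' := fun (z : ℂ) (t : ℝ) => ((t ^ (b - 1) : ℝ) : ℂ) * ((t : ℂ) / (1 - z * (t : ℂ)) ^ 2))
    (bound := fun t => t ^ (b - 1) * (1 / δ ^ 2)) hU
    (Filter.Eventually.of_forall fun w => (by fun_prop : Measurable _).aestronglyMeasurable)
    ?_ (by fun_prop : Measurable _).aestronglyMeasurable ?_ (hint.mul_const _) ?_
  · exact key.2.differentiableAt
  · refine (hint.mul_const (1 / δ)).mono' (by fun_prop : Measurable _).aestronglyMeasurable ?_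
    refine (ae_restrict_mem measurableSet_Ioc).mono fun t ht => ?_
    rw [norm_mul, norm_inv, Complex.norm_real, Real.norm_of_nonneg (Real.rpow_nonneg ht.1.le _),
      ← one_div]
    have := euler_norm_bound hδ1 hδz.le ht
    have h0 := Real.rpow_nonneg ht.1.le (b - 1)
    gcongr
  · refine (ae_restrict_mem measurableSet_Ioc).mono fun t ht w hw => ?_
    have := euler_norm_bound hδ1 (le_of_lt hw) ht
    have h0 := Real.rpow_nonneg ht.1.le (b - 1)
    rw [norm_mul, norm_div, norm_pow, Complex.norm_real, Complex.norm_real, Real.norm_of_nonneg h0,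
      Real.norm_of_nonneg ht.1.le]
    have := ht.2
    gcongr
  · refine (ae_restrict_mem measurableSet_Ioc).mono fun t ht w hw => ?_
    have hne : 1 - w * (t : ℂ) ≠ 0 := by
      rw [← norm_pos_iff]; exact hδ0.trans_le (euler_norm_bound hδ1 (le_of_lt hw) ht)
    have h1 : HasDerivAt (fun w : ℂ => 1 - w * (t : ℂ)) (-(t : ℂ)) w := by
      simpa using ((hasDerivAt_id w).mul_const (t : ℂ)).const_sub 1
    have := (h1.inv hne).const_mul ((t ^ (b - 1) : ℝ) : ℂ)
    simpa using this

theorem gauss_coeff {b : ℝ} (hb : 0 < b) (n : ℕ) :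
    ((n.factorial : ℝ)⁻¹ * (ascPochhammer ℝ n).eval 1 * (ascPochhammer ℝ n).eval b *
      ((ascPochhammer ℝ n).eval (1 + b))⁻¹) = b / (b + n) := by
  have h1 : (ascPochhammer ℝ n).eval 1 = n.factorial := by simp [ascPochhammer_eval_one]
  have hpos : 0 < (ascPochhammer ℝ n).eval (1 + b) := ascPochhammer_pos n _ (by linarith)
  have h2 : b * (ascPochhammer ℝ n).eval (1 + b) = (ascPochhammer ℝ n).eval b * (b + n) := by
    rw [← ascPochhammer_succ_eval, ascPochhammer_succ_left]
    simp [add_comm]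
  have hf : (n.factorial : ℝ) ≠ 0 := by positivity
  rw [h1, inv_mul_cancel₀ hf, one_mul, ← div_eq_mul_inv, div_eq_div_iff hpos.ne' (by positivity), h2]

theorem euler_hasSum {b : ℝ} (hb : 0 < b) {z : ℝ} (hz : |z| < 1) :
    HasSum (fun n : ℕ => (1 / (b + n)) * z ^ n)
      (∫ t in Ioc (0 : ℝ) 1, t ^ (b - 1) * (1 - z * t)⁻¹) := by
  have hI : ∀ n : ℕ, ∫ t in Ioc (0 : ℝ) 1, t ^ (b - 1) * (z * t) ^ n = (1 / (b + n)) * z ^ n := by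
    intro n
    have : ∀ t ∈ Ioc (0 : ℝ) 1, t ^ (b - 1) * (z * t) ^ n = z ^ n * t ^ (b + n - 1) := by
      intro t ht
      rw [mul_pow, show b + n - 1 = (b - 1) + n by ring, Real.rpow_add ht.1, Real.rpow_natCast]
      ring
    rw [setIntegral_congr_fun measurableSet_Ioc this, integral_const_mul,
      ← intervalIntegral.integral_of_le zero_le_one, integral_rpow (Or.inl (by
        have := n.cast_nonneg (α := ℝ); linarith))]
    rw [show b + (n : ℝ) - 1 + 1 = b + n by ring, Real.one_rpow, Real.zero_rpow (by positivity)]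
    ring
  have hint : IntegrableOn (fun t : ℝ => t ^ (b - 1)) (Ioc 0 1) := by
    rw [← intervalIntegrable_iff_integrableOn_Ioc_of_le zero_le_one]
    exact intervalIntegral.intervalIntegrable_rpow' (by linarith)
  have hb1 : ∀ n : ℕ, ∀ t ∈ Ioc (0 : ℝ) 1, ‖t ^ (b - 1) * (z * t) ^ n‖ ≤ t ^ (b - 1) * |z| ^ n := by
    intro n t ht
    have h0 := Real.rpow_nonneg ht.1.le (b - 1)
    rw [norm_mul, norm_pow, norm_mul, Real.norm_of_nonneg h0, Real.norm_of_nonneg ht.1.le,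
      Real.norm_eq_abs]
    have h2 : |z| * t ≤ |z| := mul_le_of_le_one_right (abs_nonneg _) ht.2
    exact mul_le_mul_of_nonneg_left (pow_le_pow_left₀ (mul_nonneg (abs_nonneg _) ht.1.le) h2 n) h0
  have hn : ∀ n : ℕ, IntegrableOn (fun t : ℝ => t ^ (b - 1) * (z * t) ^ n) (Ioc 0 1) := fun n =>
    (hint.mul_const (|z| ^ n)).mono' (by fun_prop : Measurable _).aestronglyMeasurable
      ((ae_restrict_mem measurableSet_Ioc).mono (hb1 n))
  have hs := hasSum_integral_of_summable_integral_norm hn (by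
    refine Summable.of_nonneg_of_le (fun n => by positivity) (fun n => ?_)
      ((summable_geometric_of_lt_one (abs_nonneg z) hz).mul_left
        (∫ t in Ioc (0 : ℝ) 1, t ^ (b - 1)))
    rw [← integral_mul_const]
    exact setIntegral_mono_on (hn n).norm (hint.mul_const _) measurableSet_Ioc (hb1 n))
  simp only [hI] at hs
  suffices hE : (∫ t in Ioc (0 : ℝ) 1, t ^ (b - 1) * (1 - z * t)⁻¹) =
      ∫ t in Ioc (0 : ℝ) 1, ∑' n : ℕ, t ^ (b - 1) * (z * t) ^ n by
    rw [hE]; exact hs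
  refine setIntegral_congr_fun measurableSet_Ioc fun t ht => ?_
  have : |z * t| < 1 := by
    rw [abs_mul, abs_of_pos ht.1]
    nlinarith [ht.1, ht.2, abs_nonneg z]
  simp only [tsum_mul_left]
  rw [tsum_geometric_of_abs_lt_one this]

theorem exists_gaussContinuation {b : ℝ} (hb : 0 < b) :
    ∃ f, IsGaussContinuation 1 b (1 + b) f := by
  set g : ℂ → ℂ := fun z => ∫ t in Ioc (0 : ℝ) 1, ((t ^ (b - 1) : ℝ) : ℂ) * (1 - z * (t : ℂ))⁻¹
    with hg
  have hU : IsOpen {w : ℂ | w.re < 1} := isOpen_lt Complex.continuous_re continuous_const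
  have hga : AnalyticOnNhd ℂ g {w : ℂ | w.re < 1} :=
    DifferentiableOn.analyticOnNhd
      (fun w hw => (euler_hasDerivAt hb hw).differentiableWithinAt) hU
  refine ⟨fun z => b * (g (z : ℂ)).re, ?_, ?_⟩
  · intro x hx
    have h1 : AnalyticAt ℝ g (x : ℂ) := (hga x (by simpa using hx)).restrictScalars
    have h2 : AnalyticAt ℝ (fun y : ℝ => g (y : ℂ)) x :=
      h1.comp (Complex.ofRealCLM.analyticAt x)
    exact analyticAt_const.mul ((Complex.reCLM.analyticAt _).comp h2)
  · intro z hz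
    have hr : g (z : ℂ) = ((∫ t in Ioc (0 : ℝ) 1, t ^ (b - 1) * (1 - z * t)⁻¹ : ℝ) : ℂ) := by
      rw [hg, ← integral_complex_ofReal]
      refine integral_congr_ae (Filter.Eventually.of_forall fun t => ?_)
      push_cast
      rfl
    simp only [hr, Complex.ofReal_re]
    rw [ordinaryHypergeometric_eq_tsum, ← (euler_hasSum hb hz).tsum_eq, ← tsum_mul_left]
    refine tsum_congr fun n => ?_
    rw [gauss_coeff hb n, smul_eq_mul]
    ring

theorem gaussHypergeometric_spec {b : ℝ} (hb : 0 < b) :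
    IsGaussContinuation 1 b (1 + b) (gaussHypergeometric 1 b (1 + b)) :=
  Classical.epsilon_spec (exists_gaussContinuation hb)

/-- `𝓕(s, x) = x² ₂F₁(1, 2/α; 1 + 2/α; -x^α / s)`. -/
def calF (α s x : ℝ) : ℝ :=
  x ^ 2 * gaussHypergeometric 1 (2 / α) (1 + 2 / α) (-(1 / s) * x ^ α)

/-! ### Explicit expressions for the Laplace transform -/

/-- `φ₀ = arcsin (D / d)`. -/
def phi0 (D d : ℝ) : ℝ := Real.arcsin (D / d)

/-- `φ₁(r) = arccos ((r² + d² - D²) / (2 d r))`. -/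
def phi1 (D d r : ℝ) : ℝ := Real.arccos ((r ^ 2 + d ^ 2 - D ^ 2) / (2 * d * r))

/-- `R₁(θ) = d cos θ + √(D² - d² sin² θ)`. -/
def R1 (D d θ : ℝ) : ℝ := d * Real.cos θ + Real.sqrt (D ^ 2 - d ^ 2 * Real.sin θ ^ 2)

/-- `R̂₁(θ) = d cos θ - √(D² - d² sin² θ)`. -/
def R1hat (D d θ : ℝ) : ℝ := d * Real.cos θ - Real.sqrt (D ^ 2 - d ^ 2 * Real.sin θ ^ 2)

/-- `A^d(s)` at serving distance `r`. -/
def ltA (lam α D d s r : ℝ) : ℝ :=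
  Real.exp (Real.pi * lam * calF α s r - lam * ∫ θ in (0 : ℝ)..Real.pi, calF α s (R1 D d θ))

/-- `B^d(s)` at serving distance `r`. -/
def ltB (lam α D d s r : ℝ) : ℝ :=
  Real.exp (phi1 D d r * lam * calF α s r -
    lam * ∫ θ in (0 : ℝ)..(phi1 D d r), calF α s (R1 D d θ))

/-- `C^d(s)` at serving distance `r`. -/
def ltC (lam α D d s r : ℝ) : ℝ :=
  ltB lam α D d s r * Real.exp (-lam * ∫ θ in (phi1 D d r)..(phi0 D d),
    (calF α s (R1 D d θ) - calF α s (R1hat D d θ)))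

open Classical in
/-- The piecewise expression. The three cases are disjoint and exhaust the values
`max 0 (d - D) ≤ r < d + D`; outside of them (where no serving distance lies, almost surely)
the value is set to `0`. -/
def ltClosest (lam α D d s r : ℝ) : ℝ :=
  if d ≤ D ∧ 0 ≤ r ∧ r < D - d then ltA lam α D d s r
  else if (d ≤ D ∧ D - d ≤ r ∧ r < D + d) ∨
      (D < d ∧ Real.sqrt (d ^ 2 - D ^ 2) ≤ r ∧ r < d + D) then ltB lam α D d s r
  else if D < d ∧ d - D ≤ r ∧ r < Real.sqrt (d ^ 2 - D ^ 2) then ltC lam α D d s r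
  else 0

/-! ### The network model -/

/-- The Euclidean plane. -/
abbrev Plane := EuclideanSpace ℝ (Fin 2)

variable {Ω : Type*}

/-- The number of points of the point process `{X i}` in the set `B`. -/
def pointCount (X : ℕ → Ω → Plane) (B : Set Plane) (ω : Ω) : ℕ∞ :=
  {i : ℕ | X i ω ∈ B}.encard

/-- The random points `X 0, X 1, …` are an enumeration of a homogeneous Poisson point process of
intensity `lam` on the plane: the number of points in a bounded Borel set `B` is Poisson with mean
`lam * area B`, and the numbers of points in disjoint bounded Borel sets are independent. -/
structure IsHPPP [MeasurableSpace Ω] (lam : ℝ) (X : ℕ → Ω → Plane) (μ : Measure Ω) : Prop where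
  measurable : ∀ i, Measurable (X i)
  law_count : ∀ B : Set Plane, MeasurableSet B → Bornology.IsBounded B →
    μ.map (pointCount X B) =
      (poissonMeasure (Real.toNNReal (lam * volume.real B))).map (fun k : ℕ => (k : ℕ∞))
  indep_count : ∀ (n : ℕ) (B : Fin n → Set Plane),
    (∀ j, MeasurableSet (B j) ∧ Bornology.IsBounded (B j)) → Pairwise (Function.onFun Disjoint B) →
    iIndepFun (fun j => pointCount X (B j)) μ

/-- Rayleigh fading: the power gains `h i` (of the points `X i`) are i.i.d. exponential with
mean `1` and independent of the point process. -/
structure IsRayleighFading [MeasurableSpace Ω] (X : ℕ → Ω → Plane) (h : ℕ → Ω → ℝ)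
    (μ : Measure Ω) : Prop where
  measurable : ∀ i, Measurable (h i)
  law : ∀ i, μ.map (h i) = expMeasure 1
  iIndep : iIndepFun h μ
  indep_points : IndepFun (fun ω i => X i ω) (fun ω i => h i ω) μ

/-- The event that the process restricted to the region `A` has at least one point. -/
def nonemptyEvent (X : ℕ → Ω → Plane) (A : Set Plane) : Set Ω := {ω | ∃ i, X i ω ∈ A}

/-- The law of the network conditioned on the cluster having at least one transmitter. -/
abbrev conditionedLaw [MeasurableSpace Ω] (μ : Measure Ω) (X : ℕ → Ω → Plane) (A : Set Plane) :
    Measure Ω :=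
  ProbabilityTheory.cond μ (nonemptyEvent X A)

/-- The index of the serving transmitter: a point in `A` nearest to the receiver at the origin.
Ties (a null event) are broken by taking the least index. -/
def servingIndex (X : ℕ → Ω → Plane) (A : Set Plane) (ω : Ω) : ℕ :=
  sInf {i | X i ω ∈ A ∧ ∀ j, X j ω ∈ A → ‖X i ω‖ ≤ ‖X j ω‖}

/-- The serving distance `R_c`. -/
def servingDistance (X : ℕ → Ω → Plane) (A : Set Plane) (ω : Ω) : ℝ :=
  ‖X (servingIndex X A ω) ω‖

open Classical in
/-- The interference: the sum of `h_y ‖y‖^(-α)` over the points `y` in `A` other than the serving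
one. Almost surely this is a finite sum. -/
def interference (α : ℝ) (X : ℕ → Ω → Plane) (h : ℕ → Ω → ℝ) (A : Set Plane) (ω : Ω) : ℝ :=
  ∑' i, if X i ω ∈ A ∧ i ≠ servingIndex X A ω then h i ω * ‖X i ω‖ ^ (-α) else 0

end SingleCluster

end

/-! For a bounded Borel region `A`, the points of `A` beyond the nearest one are, given `R_c = r`,
still Poisson on `{y ∈ A : ‖y‖ > r}`. An exponential gain at distance `ρ` contributes the factor `1
/ (1 + s ρ^(-α))`, so the Poisson Laplace functional gives `E[exp (-s I) | R_c = r] = exp (-lam *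
outerIntegral α s A r)`. Everything else is the evaluation of this planar integral for a disk.

Evaluation. Euler's integral and the substitution `t = u^α` show that `calF α s` is a primitive of
`2ρ / (1 + ρ^α / s)`, which is twice the polar integrand (`calF_eq_integral`,
`mul_one_sub_fadingFactor`). Each ray from the origin therefore contributes a difference of values
of `calF` at the ends of its part lying in the disk beyond `r`. The law of cosines (`phi1`) and the
power of the origin with respect to the circle (`R1hat_mul_R1`) decide whether this part starts at
`r`, starts at `R1hat`, or is empty; the three regimes of `r` are `ltA_eq`, `ltB_eq`, `ltC_eq`.

Probability. Independence is given only for counts in disjoint bounded sets, so conditioning on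
`R_c` goes through thin annular shells. Restricted to the event that shell `j` is the first nonempty
one, the expected product over later shells factorises, and the Poisson generating function yields
the exponent (`IsHPPP.integral_firstCellWeight`). Refining the mesh gives `setIntegral_tailProduct`.
Fading is integrated out in `setIntegral_exp_interference`, which needs that ties in norm are null.
Testing against bounded continuous functions of `R_c` identifies the conditional transform for each
`s`; continuity in `log s` then makes one null set serve all `s > 0`. -/

namespace SingleCluster

/-! ### The hypergeometric function as a radial primitive -/

/-- Identity theorem on the connected set `(-∞, 1)`: Euler's integral is analytic there and has the
Gauss series near `0`, which pins down the function chosen by `Classical.epsilon`. -/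
theorem gaussHypergeometric_eq_integral {b : ℝ} (hb : 0 < b) {z : ℝ} (hz : z < 1) :
    gaussHypergeometric 1 b (1 + b) z =
      b * ∫ t in Ioc (0 : ℝ) 1, t ^ (b - 1) * (1 - z * t)⁻¹ := by
  set g : ℂ → ℂ := fun z => ∫ t in Ioc (0 : ℝ) 1, ((t ^ (b - 1) : ℝ) : ℂ) * (1 - z * (t : ℂ))⁻¹
    with hg
  have hr : ∀ z : ℝ, (g (z : ℂ)).re = ∫ t in Ioc (0 : ℝ) 1, t ^ (b - 1) * (1 - z * t)⁻¹ := by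
    intro z
    have : g (z : ℂ) = ((∫ t in Ioc (0 : ℝ) 1, t ^ (b - 1) * (1 - z * t)⁻¹ : ℝ) : ℂ) := by
      rw [hg, ← integral_complex_ofReal]
      refine integral_congr_ae (Filter.Eventually.of_forall fun t => ?_)
      push_cast
      rfl
    rw [this, Complex.ofReal_re]
  have hU : IsOpen {w : ℂ | w.re < 1} := isOpen_lt Complex.continuous_re continuous_const
  have hga : AnalyticOnNhd ℂ g {w : ℂ | w.re < 1} :=
    DifferentiableOn.analyticOnNhd
      (fun w hw => (euler_hasDerivAt hb hw).differentiableWithinAt) hU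
  have han : AnalyticOnNhd ℝ (fun z : ℝ => b * (g (z : ℂ)).re) (Iio 1) := by
    intro x hx
    have h1 : AnalyticAt ℝ g (x : ℂ) := (hga x (by simpa using hx)).restrictScalars
    have h2 : AnalyticAt ℝ (fun y : ℝ => g (y : ℂ)) x :=
      h1.comp (Complex.ofRealCLM.analyticAt x)
    exact analyticAt_const.mul ((Complex.reCLM.analyticAt _).comp h2)
  have hspec := gaussHypergeometric_spec hb
  have heq := hspec.1.eqOn_of_preconnected_of_eventuallyEq han isPreconnected_Iio
    (z₀ := 0) (by simp) ?_
  · rw [heq hz]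
    simp only [hr]
  · have : ∀ᶠ z : ℝ in nhds 0, |z| < 1 := by
      have : ContinuousAt (fun z : ℝ => |z|) 0 := continuous_abs.continuousAt
      exact this.eventually_lt continuousAt_const (by simp)
    filter_upwards [this] with z hz
    rw [hspec.2 z hz, hr, ordinaryHypergeometric_eq_tsum, ← (euler_hasSum hb hz).tsum_eq,
      ← tsum_mul_left]
    refine tsum_congr fun n => ?_
    rw [gauss_coeff hb n, smul_eq_mul]
    ring

/-- The density `2ρ / (1 + ρ^α / s)`, of which `𝓕(s, ·)` is the primitive vanishing at `0`. -/
noncomputable def radialDensity (α s ρ : ℝ) : ℝ := 2 * ρ * (1 + ρ ^ α / s)⁻¹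

theorem one_add_rpow_div_pos {α s ρ : ℝ} (hs : 0 < s) (hρ : 0 ≤ ρ) : 0 < 1 + ρ ^ α / s := by
  have := Real.rpow_nonneg hρ α
  positivity

/-- Substitute `t = u^α` in Euler's integral, then `ρ = x u`. The factor `2/α` cancels the
Jacobian's `α`, and `x²` absorbs the rescaling, including at `x = 0`. -/
theorem calF_eq_integral {α s x : ℝ} (hα : 2 < α) (hs : 0 < s) (hx : 0 ≤ x) :
    calF α s x = ∫ ρ in (0 : ℝ)..x, radialDensity α s ρ := by
  have hα0 : 0 < α := by linarith
  have hxα : 0 ≤ x ^ α := Real.rpow_nonneg hx α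
  rw [calF, gaussHypergeometric_eq_integral (by positivity) (by
    have : 0 ≤ 1 / s * x ^ α := by positivity
    linarith)]
  -- Extended by zero because the change of variables `t = u^α` is made on the half-line; it maps
  -- `(0, 1]` onto itself.
  set h : ℝ → ℝ := (Ioc (0:ℝ) 1).indicator
    fun t => t ^ (2 / α - 1) * (1 - -(1 / s) * x ^ α * t)⁻¹ with hh
  have h1 : ∫ t in Ioc (0 : ℝ) 1, t ^ (2 / α - 1) * (1 - -(1 / s) * x ^ α * t)⁻¹
      = ∫ t in Ioi (0:ℝ), h t := by
    rw [hh, setIntegral_indicator measurableSet_Ioc]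
    congr 2
    ext t; simp +contextual
  have h2 : ∫ u in Ioi (0:ℝ), (α * u ^ (α - 1)) • h (u ^ α)
      = ∫ u in Ioi (0:ℝ), (Ioc (0:ℝ) 1).indicator
        (fun u => α * (u * (1 + (x * u) ^ α / s)⁻¹)) u := by
    refine setIntegral_congr_fun measurableSet_Ioi fun u hu => ?_
    have hu : 0 < u := hu
    by_cases hu1 : u ≤ 1
    · have : u ^ α ∈ Ioc (0:ℝ) 1 := ⟨Real.rpow_pos_of_pos hu _, Real.rpow_le_one hu.le hu1 hα0.le⟩
      simp only [hh]
      rw [indicator_of_mem this, indicator_of_mem (show u ∈ Ioc (0:ℝ) 1 from ⟨hu, hu1⟩),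
        Real.mul_rpow hx hu.le, ← Real.rpow_mul hu.le, smul_eq_mul]
      have e : u ^ (α - 1) * u ^ (α * (2 / α - 1)) = u := by
        rw [← Real.rpow_add hu]
        have : α - 1 + α * (2 / α - 1) = 1 := by field_simp; ring
        rw [this, Real.rpow_one]
      have e2 : (1 - -(1 / s) * x ^ α * u ^ α) = 1 + x ^ α * u ^ α / s := by ring
      rw [e2]
      calc _ = α * ((u ^ (α - 1) * u ^ (α * (2 / α - 1))) * (1 + x ^ α * u ^ α / s)⁻¹) := by ring
        _ = _ := by rw [e]
    · have : u ^ α ∉ Ioc (0:ℝ) 1 := by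
        have := Real.one_lt_rpow (not_le.1 hu1) hα0
        simp [this]
      simp only [hh]
      rw [indicator_of_notMem this, indicator_of_notMem (by simp [hu1]), smul_zero]
  rw [h1, ← integral_comp_rpow_Ioi_of_pos hα0, h2, setIntegral_indicator measurableSet_Ioc]
  have h3 : Ioi (0:ℝ) ∩ Ioc 0 1 = Ioc 0 1 := by ext t; simp +contextual
  rw [h3, integral_const_mul, ← intervalIntegral.integral_of_le zero_le_one]
  have h4 : ∫ u in (0:ℝ)..1, x * (2 * x * (u * (1 + (x * u) ^ α / s)⁻¹))
      = ∫ ρ in (0 : ℝ)..x, radialDensity α s ρ := by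
    have := intervalIntegral.smul_integral_comp_mul_left (a := 0) (b := 1) (radialDensity α s) x
    simp only [mul_zero, mul_one] at this
    rw [← this, smul_eq_mul, ← intervalIntegral.integral_const_mul]
    refine intervalIntegral.integral_congr fun u _ => ?_
    simp only [radialDensity]; ring
  rw [← h4]
  simp only [intervalIntegral.integral_const_mul]
  rw [← mul_assoc (2 / α)]
  have : 2 / α * α = 2 := by field_simp
  rw [this]
  ring

theorem continuousOn_radialDensity {α s : ℝ} (hα : 2 < α) (hs : 0 < s) :
    ContinuousOn (radialDensity α s) (Ici 0) := by
  refine ContinuousOn.mul (by fun_prop) (ContinuousOn.inv₀ ?_ fun ρ hρ =>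
    (one_add_rpow_div_pos hs hρ).ne')
  exact continuousOn_const.add
    ((Real.continuous_rpow_const (by linarith)).continuousOn.div_const s)

theorem measurable_radialDensity (α s : ℝ) : Measurable (radialDensity α s) := by
  unfold radialDensity; fun_prop

theorem intervalIntegrable_radialDensity {α s a b : ℝ} (hα : 2 < α) (hs : 0 < s)
    (ha : 0 ≤ a) (hb : 0 ≤ b) : IntervalIntegrable (radialDensity α s) volume a b :=
  ((continuousOn_radialDensity hα hs).mono fun _ hx =>
    (le_min ha hb).trans hx.1).intervalIntegrable

theorem calF_sub_calF {α s a b : ℝ} (hα : 2 < α) (hs : 0 < s) (ha : 0 ≤ a) (hb : 0 ≤ b) :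
    calF α s b - calF α s a = ∫ ρ in a..b, radialDensity α s ρ := by
  rw [calF_eq_integral hα hs ha, calF_eq_integral hα hs hb,
    intervalIntegral.integral_interval_sub_left] <;>
  exact intervalIntegrable_radialDensity hα hs (by simp) (by assumption)

theorem continuousOn_calF {α s : ℝ} (hα : 2 < α) (hs : 0 < s) :
    ContinuousOn (calF α s) (Ici 0) := by
  have hg : AnalyticOnNhd ℝ (gaussHypergeometric 1 (2 / α) (1 + 2 / α)) (Iio 1) :=
    (gaussHypergeometric_spec (by have : 0 < α := by linarith
                                  positivity)).1
  refine ContinuousOn.mul (by fun_prop) (hg.continuousOn.comp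
    (continuousOn_const.mul (Real.continuous_rpow_const (by linarith)).continuousOn) ?_)
  intro x hx
  have : 0 ≤ 1 / s * x ^ α := mul_nonneg (by positivity) (Real.rpow_nonneg hx _)
  simp only [mem_Iio]
  linarith

end SingleCluster

/-! ### The planar integral in polar coordinates -/

namespace SingleCluster

/-- The Laplace transform `E[exp (-s h ρ^(-α))]` of the power received from distance `ρ`. -/
noncomputable def fadingFactor (α s ρ : ℝ) : ℝ := (1 + s * ρ ^ (-α))⁻¹

/-- The exponent `∫ (1 - E[exp (-s h ‖y‖^(-α))]) dy` over the points of `A` beyond distance `r`. -/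
noncomputable def outerIntegral (α s : ℝ) (A : Set Plane) (r : ℝ) : ℝ :=
  ∫ y, {y | y ∈ A ∧ r < ‖y‖}.indicator (fun y => 1 - fadingFactor α s ‖y‖) y

/-- The left factor `ρ` is the polar Jacobian; the `1/2` is later cancelled by the reflection
symmetry in the angle. -/
theorem mul_one_sub_fadingFactor {α s ρ : ℝ} (hs : 0 < s) (hρ : 0 < ρ) :
    ρ * (1 - fadingFactor α s ρ) = radialDensity α s ρ / 2 := by
  have h1 := Real.rpow_pos_of_pos hρ α
  rw [fadingFactor, radialDensity, Real.rpow_neg hρ.le]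
  field_simp
  ring

/-- The signed excess `|ρ e^{iθ} - d|² - D²`. -/
noncomputable def diskExcess (D d θ ρ : ℝ) : ℝ := ρ ^ 2 - 2 * ρ * d * Real.cos θ + d ^ 2 - D ^ 2

/-- The radial integral over the part beyond distance `r` of the ray at angle `θ`. -/
noncomputable def rayIntegral (α s D d r θ : ℝ) : ℝ :=
  ∫ ρ in Ioi (0 : ℝ), {ρ | r < ρ ∧ diskExcess D d θ ρ ≤ 0}.indicator (radialDensity α s) ρ

/-- Identify the plane with `ℂ` and rotate by minus the argument of the centre, so that the disk
becomes symmetric about the real axis. -/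
theorem exists_isometry_real (xo : Plane) : ∃ e : Plane ≃ₗᵢ[ℝ] ℂ, e xo = (‖xo‖ : ℂ) := by
  let e₀ : Plane ≃ₗᵢ[ℝ] ℂ := Complex.orthonormalBasisOneI.repr.symm
  refine ⟨e₀.trans (rotation (Circle.exp (-(e₀ xo).arg))), ?_⟩
  have h1 : ‖e₀ xo‖ = ‖xo‖ := e₀.norm_map xo
  simp only [LinearIsometryEquiv.trans_apply, rotation_apply, Circle.coe_exp]
  have h2 := Complex.norm_mul_exp_arg_mul_I (e₀ xo)
  generalize (e₀ xo).arg = a at h2 ⊢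
  rw [← h2, h1, mul_left_comm, ← Complex.exp_add]
  simp

theorem norm_polar_sub_sq (d ρ θ : ℝ) :
    ‖Complex.polarCoord.symm (ρ, θ) - (d : ℂ)‖ ^ 2 = ρ ^ 2 - 2 * ρ * d * Real.cos θ + d ^ 2 := by
  rw [Complex.polarCoord_symm_apply, ← Complex.normSq_eq_norm_sq, Complex.normSq_apply]
  simp
  simp only [← Complex.ofReal_cos, ← Complex.ofReal_sin, Complex.ofReal_re]
  nlinarith [Real.sin_sq_add_cos_sq θ]

theorem diskExcess_eq (D d θ ρ : ℝ) :
    diskExcess D d θ ρ = (ρ - d * Real.cos θ) ^ 2 - (D ^ 2 - d ^ 2 * Real.sin θ ^ 2) := by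
  rw [diskExcess, Real.sin_sq]; ring

theorem le_of_diskExcess_nonpos {D d θ ρ : ℝ} (hD : 0 < D) (hd : 0 ≤ d) (hρ : 0 < ρ)
    (h : diskExcess D d θ ρ ≤ 0) : ρ ≤ d + D := by
  rw [diskExcess] at h
  have h1 : ρ * d * Real.cos θ ≤ ρ * d :=
    mul_le_of_le_one_right (by positivity) (Real.cos_le_one θ)
  by_contra! hc
  nlinarith

theorem measurable_diskExcess (D d : ℝ) :
    Measurable fun p : ℝ × ℝ => diskExcess D d p.2 p.1 := by
  unfold diskExcess; fun_prop

/-- Needed for Fubini: the integrand vanishes for `ρ > d + D` and is at most `2 (d + D)` before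
that. -/
theorem integrableOn_polar {α s D d : ℝ} (r : ℝ) (hs : 0 < s) (hD : 0 < D)
    (hd : 0 ≤ d) : IntegrableOn (fun p : ℝ × ℝ =>
      {ρ | r < ρ ∧ diskExcess D d p.2 ρ ≤ 0}.indicator (radialDensity α s) p.1)
      (Ioi (0 : ℝ) ×ˢ Ioo (-Real.pi) Real.pi) := by
  have hmeas : Measurable (fun p : ℝ × ℝ =>
      {ρ | r < ρ ∧ diskExcess D d p.2 ρ ≤ 0}.indicator (radialDensity α s) p.1) := by
    have : (fun p : ℝ × ℝ =>
      {ρ | r < ρ ∧ diskExcess D d p.2 ρ ≤ 0}.indicator (radialDensity α s) p.1) =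
      {p : ℝ × ℝ | r < p.1 ∧ diskExcess D d p.2 p.1 ≤ 0}.indicator
        fun p => radialDensity α s p.1 := rfl
    rw [this]
    exact ((measurable_radialDensity α s).comp measurable_fst).indicator
      ((measurableSet_lt measurable_const measurable_fst).inter
        (measurableSet_le (measurable_diskExcess D d) measurable_const))
  have h1 : IntegrableOn (fun p : ℝ × ℝ =>
      {ρ | r < ρ ∧ diskExcess D d p.2 ρ ≤ 0}.indicator (radialDensity α s) p.1)
      (Ioc (0 : ℝ) (d + D) ×ˢ Ioo (-Real.pi) Real.pi) := by
    refine Measure.integrableOn_of_bounded (M := 2 * (d + D)) ?_ hmeas.aestronglyMeasurable ?_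
    · rw [Measure.volume_eq_prod, Measure.prod_prod]
      simp [ENNReal.mul_eq_top]
    · refine (ae_restrict_mem (measurableSet_Ioc.prod measurableSet_Ioo)).mono fun p hp => ?_
      refine (norm_indicator_le_norm_self _ _).trans ?_
      have hp1 := hp.1
      have h2 : 1 ≤ 1 + p.1 ^ α / s := by
        have := Real.rpow_nonneg hp1.1.le α
        have : 0 ≤ p.1 ^ α / s := by positivity
        linarith
      rw [radialDensity, norm_mul, norm_inv, Real.norm_of_nonneg (by linarith [hp1.1]),
        Real.norm_of_nonneg (by linarith)]
      have h3 : (1 + p.1 ^ α / s)⁻¹ ≤ 1 := inv_le_one_of_one_le₀ h2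
      calc 2 * p.1 * (1 + p.1 ^ α / s)⁻¹ ≤ 2 * p.1 * 1 := by
            have := hp1.1
            gcongr
        _ ≤ _ := by linarith [hp1.2]
  refine h1.of_forall_sdiff_eq_zero (measurableSet_Ioi.prod measurableSet_Ioo) ?_
  rintro ⟨ρ, θ⟩ ⟨⟨hρ, hθ⟩, h⟩
  refine indicator_of_notMem (fun hh => h ⟨⟨hρ, ?_⟩, hθ⟩) _
  exact le_of_diskExcess_nonpos hD hd hρ hh.2

theorem rayIntegral_abs (α s D d r θ : ℝ) :
    rayIntegral α s D d r |θ| = rayIntegral α s D d r θ := by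
  simp [rayIntegral, diskExcess]

theorem intervalIntegrable_rayIntegral {α s D d : ℝ} (r : ℝ) (hs : 0 < s)
    (hD : 0 < D) (hd : 0 ≤ d) {a b : ℝ} (ha : a ∈ Icc 0 Real.pi) (hb : b ∈ Icc 0 Real.pi) :
    IntervalIntegrable (rayIntegral α s D d r) volume a b := by
  have h := integrableOn_polar (α := α) r hs hD hd
  rw [IntegrableOn, Measure.volume_eq_prod, ← Measure.prod_restrict] at h
  have h2 : IntegrableOn (rayIntegral α s D d r) (Ioo (-Real.pi) Real.pi) := h.integral_prod_right
  have h3 : IntegrableOn (rayIntegral α s D d r) (Icc (-Real.pi) Real.pi) := by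
    rwa [integrableOn_Icc_iff_integrableOn_Ioo]
  refine (h3.mono_set (fun x hx => ?_)).intervalIntegrable
  have hp := Real.pi_pos
  rw [uIcc] at hx
  exact ⟨by linarith [le_min ha.1 hb.1, hx.1], hx.2.trans (max_le ha.2 hb.2)⟩

theorem outerIntegral_closedBall {α s D : ℝ} (r : ℝ) (hs : 0 < s) (hD : 0 < D)
    (xo : Plane) : outerIntegral α s (Metric.closedBall xo D) r =
      ∫ θ in (0 : ℝ)..Real.pi, rayIntegral α s D ‖xo‖ r θ := by
  obtain ⟨e, he⟩ := exists_isometry_real xo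
  set d := ‖xo‖ with hd
  have h1 : outerIntegral α s (Metric.closedBall xo D) r =
      ∫ z : ℂ, {z : ℂ | ‖z - d‖ ≤ D ∧ r < ‖z‖}.indicator (fun z => 1 - fadingFactor α s ‖z‖) z := by
    rw [outerIntegral, ← e.measurePreserving.integral_comp e.toHomeomorph.measurableEmbedding]
    congr 1
    ext y
    have : ‖e y - d‖ = ‖y - xo‖ := by rw [← he, ← map_sub, e.norm_map]
    simp only [indicator, mem_ofPred_eq, Metric.mem_closedBall, dist_eq_norm, this, e.norm_map]
  rw [h1, ← Complex.integral_comp_polarCoord_symm]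
  have h2 : ∀ p ∈ polarCoord.target, p.1 • {z : ℂ | ‖z - d‖ ≤ D ∧ r < ‖z‖}.indicator
      (fun z => 1 - fadingFactor α s ‖z‖) (Complex.polarCoord.symm p) =
      {ρ | r < ρ ∧ diskExcess D d p.2 ρ ≤ 0}.indicator (radialDensity α s) p.1 / 2 := by
    rintro ⟨ρ, θ⟩ hp
    have hρ : 0 < ρ := hp.1
    have hn : ‖Complex.polarCoord.symm (ρ, θ)‖ = ρ := by
      simp [abs_of_pos hρ]
    have hD2 : ‖Complex.polarCoord.symm (ρ, θ) - (d : ℂ)‖ ≤ D ↔ diskExcess D d θ ρ ≤ 0 := by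
      rw [← sq_le_sq₀ (norm_nonneg _) hD.le, norm_polar_sub_sq, diskExcess]
      exact sub_nonpos.symm
    simp only [indicator, mem_ofPred_eq, hn, hD2, smul_eq_mul]
    by_cases hc : r < ρ ∧ diskExcess D d θ ρ ≤ 0
    · rw [if_pos hc.symm, if_pos hc, mul_one_sub_fadingFactor hs hρ]
    · rw [if_neg (fun h => hc h.symm), if_neg hc]
      simp
  rw [setIntegral_congr_fun
    (by rw [polarCoord_target]; exact measurableSet_Ioi.prod measurableSet_Ioo) h2, integral_div, polarCoord_target]
  have h3 := integrableOn_polar (α := α) r hs hD (norm_nonneg xo)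
  rw [IntegrableOn, Measure.volume_eq_prod, ← Measure.prod_restrict] at h3
  rw [Measure.volume_eq_prod, ← Measure.prod_restrict, integral_prod_symm _ h3]
  -- The angle enters only through its cosine, so the integrand is a function of `|θ|` and the
  -- integral is twice that over `(0, π)`.
  have h4 : ∀ θ, (Ioo (-Real.pi) Real.pi).indicator (rayIntegral α s D d r) θ =
      (Iio Real.pi).indicator (rayIntegral α s D d r) |θ| := by
    intro θ
    simp only [indicator, mem_Ioo, mem_Iio, abs_lt, rayIntegral_abs]
  have h5 : ∫ θ in Ioo (-Real.pi) Real.pi, rayIntegral α s D d r θ =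
      2 * ∫ θ in (0 : ℝ)..Real.pi, rayIntegral α s D d r θ := by
    rw [← integral_indicator measurableSet_Ioo]
    simp only [h4]
    rw [integral_comp_abs, setIntegral_indicator measurableSet_Iio, Ioi_inter_Iio,
      ← integral_Ioc_eq_integral_Ioo, intervalIntegral.integral_of_le Real.pi_pos.le]
  change (∫ θ in Ioo (-Real.pi) Real.pi, rayIntegral α s D d r θ) / 2 = _
  rw [h5]
  ring

end SingleCluster

/-! ### Geometry of rays and the three regimes -/

namespace SingleCluster

theorem integral_congr_Ioo {f g : ℝ → ℝ} {a b : ℝ} (hab : a ≤ b) (h : ∀ x ∈ Ioo a b, f x = g x) :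
    ∫ x in a..b, f x = ∫ x in a..b, g x := by
  rw [intervalIntegral.integral_of_le hab, intervalIntegral.integral_of_le hab,
    integral_Ioc_eq_integral_Ioo, integral_Ioc_eq_integral_Ioo]
  exact setIntegral_congr_fun measurableSet_Ioo h

theorem diskExcess_nonpos_iff {D d θ ρ : ℝ} (h : 0 ≤ D ^ 2 - d ^ 2 * Real.sin θ ^ 2) :
    diskExcess D d θ ρ ≤ 0 ↔ R1hat D d θ ≤ ρ ∧ ρ ≤ R1 D d θ := by
  rw [diskExcess_eq, sub_nonpos, R1, R1hat]
  nth_rw 1 [← Real.sq_sqrt h]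
  rw [sq_le_sq, abs_of_nonneg (Real.sqrt_nonneg _), abs_le]
  constructor <;> rintro ⟨h1, h2⟩ <;> constructor <;> linarith

/-- Power of the origin with respect to the circle: the product of the two crossing distances does
not depend on the direction. -/
theorem R1hat_mul_R1 {D d θ : ℝ} (h : 0 ≤ D ^ 2 - d ^ 2 * Real.sin θ ^ 2) :
    R1hat D d θ * R1 D d θ = d ^ 2 - D ^ 2 := by
  have h1 := Real.sq_sqrt h
  have h2 := Real.sin_sq_add_cos_sq θ
  rw [R1, R1hat]
  generalize Real.sqrt _ = S at *
  calc _ = d ^ 2 * Real.cos θ ^ 2 - S ^ 2 := by ring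
    _ = d ^ 2 * (Real.sin θ ^ 2 + Real.cos θ ^ 2) - D ^ 2 := by rw [h1]; ring
    _ = _ := by rw [h2, mul_one]

theorem R1hat_le_R1 (D d θ : ℝ) : R1hat D d θ ≤ R1 D d θ := by
  rw [R1, R1hat]
  linarith [Real.sqrt_nonneg (D ^ 2 - d ^ 2 * Real.sin θ ^ 2)]

theorem discriminant_nonneg_of_diskExcess_nonpos {D d θ ρ : ℝ} (h : diskExcess D d θ ρ ≤ 0) :
    0 ≤ D ^ 2 - d ^ 2 * Real.sin θ ^ 2 := by
  rw [diskExcess_eq] at h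
  linarith [sq_nonneg (ρ - d * Real.cos θ)]

theorem continuous_R1 (D d : ℝ) : Continuous (R1 D d) := by unfold R1; fun_prop

/-- At distance `r` the ray is inside the disk, so the part that counts runs from `r` to the exit
point. -/
theorem rayIntegral_of_lt {α s D d r θ : ℝ} (hα : 2 < α) (hs : 0 < s) (hr : 0 ≤ r)
    (h : diskExcess D d θ r ≤ 0) :
    rayIntegral α s D d r θ = calF α s (R1 D d θ) - calF α s r := by
  have hΔ := discriminant_nonneg_of_diskExcess_nonpos h
  have hr1 := (diskExcess_nonpos_iff hΔ).1 h
  rw [calF_sub_calF hα hs hr (hr.trans hr1.2), rayIntegral,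
    intervalIntegral.integral_of_le hr1.2, ← integral_indicator measurableSet_Ioi,
    ← integral_indicator measurableSet_Ioc]
  congr 1
  ext ρ
  simp only [indicator, mem_Ioi, mem_Ioc, mem_ofPred_eq, diskExcess_nonpos_iff hΔ]
  by_cases h1 : r < ρ ∧ ρ ≤ R1 D d θ
  · rw [if_pos h1, if_pos (by linarith), if_pos ⟨h1.1, by linarith, h1.2⟩]
  · rw [if_neg h1]
    split_ifs <;> tauto

/-- Here `r` lies before the entry point, so the whole chord counts and `r` drops out. -/
theorem rayIntegral_of_lt_R1hat {α s D d r θ : ℝ} (hα : 2 < α) (hs : 0 < s) (hr : 0 ≤ r)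
    (hΔ : 0 ≤ D ^ 2 - d ^ 2 * Real.sin θ ^ 2) (h : r < R1hat D d θ) :
    rayIntegral α s D d r θ = calF α s (R1 D d θ) - calF α s (R1hat D d θ) := by
  have hle := R1hat_le_R1 D d θ
  rw [calF_sub_calF hα hs (by linarith) (by linarith), rayIntegral,
    intervalIntegral.integral_of_le hle, ← integral_Icc_eq_integral_Ioc,
    ← integral_indicator measurableSet_Ioi, ← integral_indicator measurableSet_Icc]
  congr 1
  ext ρ
  simp only [indicator, mem_Ioi, mem_Icc, mem_ofPred_eq, diskExcess_nonpos_iff hΔ]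
  by_cases h1 : R1hat D d θ ≤ ρ ∧ ρ ≤ R1 D d θ
  · rw [if_pos h1, if_pos (by linarith), if_pos ⟨by linarith, h1⟩]
  · rw [if_neg h1]
    split_ifs <;> tauto

theorem rayIntegral_of_pos {α s D d r θ : ℝ}
    (h : ∀ ρ, 0 < ρ → r < ρ → 0 < diskExcess D d θ ρ) : rayIntegral α s D d r θ = 0 := by
  rw [rayIntegral, setIntegral_eq_zero_of_forall_eq_zero]
  intro ρ hρ
  refine indicator_of_notMem ?_ _
  rintro ⟨h1, h2⟩
  exact (h ρ hρ h1).not_ge h2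

theorem diskExcess_eq_phi1 {D d r θ : ℝ} (hd : 0 < d) (hr : 0 < r) :
    diskExcess D d θ r = 2 * d * r * ((r ^ 2 + d ^ 2 - D ^ 2) / (2 * d * r) - Real.cos θ) := by
  rw [diskExcess, mul_sub, mul_div_cancel₀ _ (by positivity)]; ring

/-- Law of cosines. No bound on the argument of `arccos` is needed: `Real.arccos` is antitone on all
of `ℝ`, taking the values `0` and `π` outside `[-1, 1]`. -/
theorem diskExcess_neg_of_lt_phi1 {D d r θ : ℝ} (hd : 0 < d) (hr : 0 < r) (hθ : 0 ≤ θ)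
    (h : θ < phi1 D d r) : diskExcess D d θ r < 0 := by
  rw [diskExcess_eq_phi1 hd hr]
  refine mul_neg_of_pos_of_neg (by positivity) (sub_neg.2 ?_)
  by_contra! hc
  have := Real.antitone_arccos hc
  rw [Real.arccos_cos hθ (h.le.trans (Real.arccos_le_pi _))] at this
  exact (h.trans_le this).false

theorem diskExcess_pos_of_phi1_lt {D d r θ : ℝ} (hd : 0 < d) (hr : 0 < r) (hθ : θ ≤ Real.pi)
    (h : phi1 D d r < θ) : 0 < diskExcess D d θ r := by
  rw [diskExcess_eq_phi1 hd hr]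
  refine mul_pos (by positivity) (sub_pos.2 ?_)
  by_contra! hc
  have := Real.antitone_arccos hc
  rw [Real.arccos_cos ((Real.arccos_nonneg _).trans h.le) hθ] at this
  exact (h.trans_le this).false

/-- Beyond the tangent length `√(d² - D²)` a ray that is outside the disk cannot enter it again. The
identity `e` eliminates the cosine between the excesses at `r` and at `ρ`. -/
theorem diskExcess_pos_of_lt {D d r θ ρ : ℝ} (hr : 0 < r) (hr2 : d ^ 2 - D ^ 2 ≤ r ^ 2)
    (h : 0 < diskExcess D d θ r) (hρ : r < ρ) : 0 < diskExcess D d θ ρ := by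
  have e : diskExcess D d θ ρ * r = diskExcess D d θ r * ρ
      + (ρ - r) * (ρ * r - (d ^ 2 - D ^ 2)) := by
    rw [diskExcess, diskExcess]; ring
  have h1 : 0 ≤ (ρ - r) * (ρ * r - (d ^ 2 - D ^ 2)) :=
    mul_nonneg (by linarith) (by nlinarith)
  have h2 : 0 < diskExcess D d θ r * ρ := mul_pos h (by linarith)
  exact pos_of_mul_pos_left (by linarith) hr.le

theorem phi1_mem_Icc (D d r : ℝ) : phi1 D d r ∈ Icc 0 Real.pi :=
  ⟨Real.arccos_nonneg _, Real.arccos_le_pi _⟩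

theorem phi0_mem_Icc {D d : ℝ} (hD : 0 < D) (hd : 0 ≤ d) : phi0 D d ∈ Icc 0 Real.pi :=
  ⟨Real.arcsin_nonneg.2 (by positivity),
    (Real.arcsin_le_pi_div_two _).trans (by linarith [Real.pi_pos])⟩

/-- Since `cos φ₀ = √(1 - D²/d²)`, this is the inequality of arithmetic and geometric means for `r²`
and `d² - D²`; the difference of squares below is a perfect square. -/
theorem phi1_le_phi0 {D d r : ℝ} (hD : 0 < D) (hd : D < d) (hr : 0 < r) :
    phi1 D d r ≤ phi0 D d := by
  have hd0 : 0 < d := hD.trans hd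
  have h0 := phi0_mem_Icc hD hd0.le
  rw [← Real.arccos_cos h0.1 h0.2]
  refine Real.antitone_arccos ?_
  have hm : 0 < d ^ 2 - D ^ 2 := by nlinarith
  rw [phi0, Real.cos_arcsin, Real.sqrt_le_iff]
  refine ⟨div_nonneg (by nlinarith) (by positivity), ?_⟩
  rw [div_pow, div_pow, ← sub_nonneg]
  have : (r ^ 2 + d ^ 2 - D ^ 2) ^ 2 / (2 * d * r) ^ 2 - (1 - D ^ 2 / d ^ 2) =
      (r ^ 2 - (d ^ 2 - D ^ 2)) ^ 2 / (2 * d * r) ^ 2 := by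
    field_simp; ring
  rw [this]
  positivity

theorem intervalIntegrable_calF_comp {α s : ℝ} (hα : 2 < α) (hs : 0 < s) {R : ℝ → ℝ}
    (hR : Continuous R) {a b : ℝ} (hab : a ≤ b) (h : ∀ θ ∈ Ioo a b, 0 ≤ R θ) :
    IntervalIntegrable (fun θ => calF α s (R θ)) volume a b := by
  rw [intervalIntegrable_iff_integrableOn_Ioo_of_le hab]
  -- Continuity of `calF` is known only on `[0, ∞)`, hence the clamp.
  have hc : Continuous (fun θ => calF α s (max (R θ) 0)) :=
    (continuousOn_calF hα hs).comp_continuous (hR.max continuous_const) fun θ => mem_Ici.2 (le_max_right _ _)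
  refine (((hc.intervalIntegrable a b).1.mono_set Ioo_subset_Ioc_self).congr_fun
    (fun θ hθ => ?_) measurableSet_Ioo)
  simp only [max_eq_left (h θ hθ)]

theorem integral_rayIntegral_of_diskExcess_nonpos {α s D d r b : ℝ} (hα : 2 < α) (hs : 0 < s)
    (hr : 0 ≤ r) (hb : 0 ≤ b) (h : ∀ θ ∈ Ioo 0 b, diskExcess D d θ r ≤ 0) :
    ∫ θ in (0 : ℝ)..b, rayIntegral α s D d r θ =
      (∫ θ in (0 : ℝ)..b, calF α s (R1 D d θ)) - b * calF α s r := by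
  rw [integral_congr_Ioo hb fun θ hθ => rayIntegral_of_lt hα hs hr (h θ hθ),
    intervalIntegral.integral_sub, intervalIntegral.integral_const]
  · simp
  · refine intervalIntegrable_calF_comp hα hs (continuous_R1 D d) hb fun θ hθ => ?_
    have h1 := h θ hθ
    have := (diskExcess_nonpos_iff (discriminant_nonneg_of_diskExcess_nonpos h1)).1 h1
    linarith
  · exact intervalIntegrable_const

/-- The circle of radius `r` about the origin lies inside the disk, so every ray starts at `r`. -/
theorem ltA_eq {lam α D s r : ℝ} (hα : 2 < α) (hs : 0 < s) (hD : 0 < D) (xo : Plane)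
    (hr : 0 < r) (h : r < D - ‖xo‖) :
    ltA lam α D ‖xo‖ s r =
      Real.exp (-(lam * outerIntegral α s (Metric.closedBall xo D) r)) := by
  have hd := norm_nonneg xo
  rw [ltA, outerIntegral_closedBall r hs hD,
    integral_rayIntegral_of_diskExcess_nonpos hα hs hr.le Real.pi_pos.le]
  · congr 1; ring
  · intro θ _
    rw [diskExcess]
    have h1 : -(r * ‖xo‖) ≤ r * ‖xo‖ * Real.cos θ := by
      nlinarith [Real.neg_one_le_cos θ, mul_nonneg hr.le hd]
    nlinarith

/-- Rays with angle below `φ₁` are inside the disk at distance `r`; the others are outside it there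
and, `r` being at least the tangent length, remain outside. -/
theorem ltB_eq {lam α D s r : ℝ} (hα : 2 < α) (hs : 0 < s) (hD : 0 < D) (xo : Plane)
    (hd : 0 < ‖xo‖) (hr : 0 < r) (h : ‖xo‖ ^ 2 - D ^ 2 ≤ r ^ 2) :
    ltB lam α D ‖xo‖ s r =
      Real.exp (-(lam * outerIntegral α s (Metric.closedBall xo D) r)) := by
  set d := ‖xo‖
  have h1 := phi1_mem_Icc D d r
  have hi : ∀ {a b}, a ∈ Icc 0 Real.pi → b ∈ Icc 0 Real.pi →
    IntervalIntegrable (rayIntegral α s D d r) volume a b := fun ha hb =>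
      intervalIntegrable_rayIntegral r hs hD hd.le ha hb
  have hπ : Real.pi ∈ Icc 0 Real.pi := ⟨Real.pi_pos.le, le_rfl⟩
  rw [ltB, outerIntegral_closedBall r hs hD,
    ← intervalIntegral.integral_add_adjacent_intervals (hi ⟨le_rfl, hπ.1⟩ h1) (hi h1 hπ),
    integral_rayIntegral_of_diskExcess_nonpos hα hs hr.le h1.1
      fun θ hθ => (diskExcess_neg_of_lt_phi1 hd hr hθ.1.le hθ.2).le,
    integral_congr_Ioo (g := fun _ => 0) h1.2]
  · congr 1; simp; ring
  · intro θ hθ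
    exact rayIntegral_of_pos fun ρ _ hρ =>
      diskExcess_pos_of_lt hr h (diskExcess_pos_of_phi1_lt hd hr hθ.2.le hθ.1) hρ

/-- Below the tangent length there are three sectors: up to `φ₁` the ray is inside the disk at
distance `r`, between `φ₁` and `φ₀` it meets the disk in a full chord beyond `r`, and past `φ₀` it
misses the disk. -/
theorem ltC_eq {lam α D s r : ℝ} (hα : 2 < α) (hs : 0 < s) (hD : 0 < D) (xo : Plane)
    (hd : D < ‖xo‖) (hr : 0 < r) (h : r ^ 2 < ‖xo‖ ^ 2 - D ^ 2) :
    ltC lam α D ‖xo‖ s r =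
      Real.exp (-(lam * outerIntegral α s (Metric.closedBall xo D) r)) := by
  set d := ‖xo‖
  have hd0 : 0 < d := hD.trans hd
  have h1 := phi1_mem_Icc D d r
  have h0 := phi0_mem_Icc hD hd0.le
  have h10 := phi1_le_phi0 hD hd hr
  have hi : ∀ {a b}, a ∈ Icc 0 Real.pi → b ∈ Icc 0 Real.pi →
    IntervalIntegrable (rayIntegral α s D d r) volume a b := fun ha hb =>
      intervalIntegrable_rayIntegral r hs hD hd0.le ha hb
  have hπ : Real.pi ∈ Icc 0 Real.pi := ⟨Real.pi_pos.le, le_rfl⟩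
  have h02 : phi0 D d ≤ Real.pi / 2 := Real.arcsin_le_pi_div_two _
  have hDd : D / d ∈ Icc (-1 : ℝ) 1 :=
    ⟨by have : 0 < D / d := by positivity
        linarith, (div_le_one hd0).2 hd.le⟩
  rw [ltC, ltB, ← Real.exp_add, outerIntegral_closedBall r hs hD,
    ← intervalIntegral.integral_add_adjacent_intervals (hi ⟨le_rfl, hπ.1⟩ h0) (hi h0 hπ),
    ← intervalIntegral.integral_add_adjacent_intervals (hi ⟨le_rfl, hπ.1⟩ h1) (hi h1 h0),
    integral_rayIntegral_of_diskExcess_nonpos hα hs hr.le h1.1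
      fun θ hθ => (diskExcess_neg_of_lt_phi1 hd0 hr hθ.1.le hθ.2).le,
    integral_congr_Ioo (g := fun _ => 0) h0.2, integral_congr_Ioo h10]
  · congr 1; simp; ring
  · intro θ hθ
    have hθ2 : θ < Real.pi / 2 := hθ.2.trans_le h02
    have hθ0 : 0 < θ := h1.1.trans_lt hθ.1
    have hsin : Real.sin θ < D / d := by
      rw [← Real.sin_arcsin hDd.1 hDd.2]
      exact Real.strictMonoOn_sin ⟨by linarith, hθ2.le⟩ ⟨by
        have := h0.1
        rw [phi0] at this
        linarith, h02⟩ hθ.2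
    have hsin0 : 0 ≤ Real.sin θ := Real.sin_nonneg_of_nonneg_of_le_pi hθ0.le (by linarith)
    have hΔ : 0 ≤ D ^ 2 - d ^ 2 * Real.sin θ ^ 2 := by
      rw [lt_div_iff₀ hd0] at hsin
      have : 0 ≤ Real.sin θ * d := by positivity
      nlinarith
    have hcos : 0 < Real.cos θ := Real.cos_pos_of_mem_Ioo ⟨by linarith, hθ2⟩
    have hR : 0 < R1 D d θ := by
      rw [R1]
      have := Real.sqrt_nonneg (D ^ 2 - d ^ 2 * Real.sin θ ^ 2)
      positivity
    refine (rayIntegral_of_lt_R1hat hα hs hr.le hΔ ?_).symm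
    -- The point at distance `r` is outside the disk, so otherwise it is past the exit point; then
    -- `r² > R1hat * R1 = d² - D²`, against `h`.
    by_contra! hc
    have hq := diskExcess_pos_of_phi1_lt hd0 hr (by linarith) hθ.1
    have hrR : R1 D d θ < r := by
      by_contra! hc2
      exact hq.not_ge ((diskExcess_nonpos_iff hΔ).2 ⟨hc, hc2⟩)
    have := R1hat_mul_R1 hΔ
    have := R1hat_le_R1 D d θ
    nlinarith
  · intro θ hθ
    refine rayIntegral_of_pos fun ρ hρ _ => ?_
    -- Up to `π/2` the line misses the disk because the discriminant is negative; past `π/2` the ray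
    -- points away from the centre.
    rcases le_or_gt θ (Real.pi / 2) with hθ2 | hθ2
    · have hsin : D / d < Real.sin θ := by
        rw [← Real.sin_arcsin hDd.1 hDd.2]
        exact Real.strictMonoOn_sin ⟨by linarith [h0.1, Real.pi_pos], h02⟩
          ⟨by linarith [h0.1, hθ.1], hθ2⟩ hθ.1
      rw [div_lt_iff₀ hd0] at hsin
      rw [diskExcess_eq]
      nlinarith [sq_nonneg (ρ - d * Real.cos θ)]
    · have hcos : Real.cos θ ≤ 0 :=
        Real.cos_nonpos_of_pi_div_two_le_of_le hθ2.le (by linarith [hθ.2])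
      rw [diskExcess]
      have : 0 ≤ ρ * d * (-Real.cos θ) := mul_nonneg (by positivity) (by linarith)
      nlinarith

/-- Away from the degenerate values of `r`, the piecewise expression is the exponential of the
planar integral over the part of the disk beyond distance `r`. -/
theorem ltClosest_eq {lam α D s r : ℝ} (hα : 2 < α) (hs : 0 < s) (hD : 0 < D) (xo : Plane)
    (hr : 0 < r) (h1 : ‖xo‖ - D ≤ r) (h2 : r < ‖xo‖ + D) :
    ltClosest lam α D ‖xo‖ s r =
      Real.exp (-(lam * outerIntegral α s (Metric.closedBall xo D) r)) := by
  rw [ltClosest]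
  have hd := norm_nonneg xo
  split_ifs with hA hB hC
  · exact ltA_eq hα hs hD xo hr hA.2.2
  · rcases hB with hB | hB
    · refine ltB_eq hα hs hD xo ?_ hr (by nlinarith)
      -- For a centre at the origin, `[D - d, D + d)` is empty, so the division by `d` in `φ₁` is
      -- harmless.
      by_contra! hc
      linarith [hB.2.1, hB.2.2]
    · refine ltB_eq hα hs hD xo (by linarith) hr ?_
      exact Real.sqrt_le_left hr.le |>.1 hB.2.1
  · exact ltC_eq hα hs hD xo hC.1 hr ((Real.lt_sqrt hr.le).1 hC.2.2)
  · exfalso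
    rcases le_or_gt ‖xo‖ D with h | h
    · rcases lt_or_ge r (D - ‖xo‖) with h' | h'
      · exact hA ⟨h, hr.le, h'⟩
      · exact hB (Or.inl ⟨h, h', by linarith⟩)
    · rcases lt_or_ge r (Real.sqrt (‖xo‖ ^ 2 - D ^ 2)) with h' | h'
      · exact hC ⟨h, h1, h'⟩
      · exact hB (Or.inr ⟨h, h', h2⟩)

end SingleCluster

/-! ### Measurability of the serving index and distance -/

namespace SingleCluster

open Filter Topology

variable {Ω : Type*}

open Classical in
/-- The path gain from the `i`-th point if that point is an interferer, and `0` otherwise. -/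
noncomputable def interfererGain (α : ℝ) (X : ℕ → Ω → Plane) (A : Set Plane) (i : ℕ) (ω : Ω) : ℝ :=
  if X i ω ∈ A ∧ i ≠ servingIndex X A ω then ‖X i ω‖ ^ (-α) else 0

theorem interfererGain_nonneg (α : ℝ) (X : ℕ → Ω → Plane) (A : Set Plane) (i : ℕ) (ω : Ω) :
    0 ≤ interfererGain α X A i ω := by
  rw [interfererGain]
  split_ifs
  · exact Real.rpow_nonneg (norm_nonneg _) _
  · exact le_rfl

theorem interference_eq (α : ℝ) (X : ℕ → Ω → Plane) (h : ℕ → Ω → ℝ) (A : Set Plane) (ω : Ω) :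
    interference α X h A ω = ∑' i, h i ω * interfererGain α X A i ω := by
  rw [interference]
  refine tsum_congr fun i => ?_
  rw [interfererGain, mul_ite, mul_zero]

section Measurability

variable [MeasurableSpace Ω] {X : ℕ → Ω → Plane} {A : Set Plane}

theorem measurable_sInf_setOf {P : ℕ → Ω → Prop} (hP : ∀ i, MeasurableSet {ω | P i ω}) :
    Measurable fun ω => sInf {i | P i ω} := by
  refine measurable_to_countable' fun n => ?_
  -- The second piece accounts for `sInf ∅ = 0`.
  have : (fun ω => sInf {i | P i ω}) ⁻¹' {n} =
      ({ω | P n ω} ∩ ⋂ m, ⋂ (_ : m < n), {ω | P m ω}ᶜ) ∪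
        (if n = 0 then ⋂ m, {ω | P m ω}ᶜ else ∅) := by
    ext ω
    simp only [mem_preimage, mem_singleton_iff, mem_union, mem_inter_iff, mem_ofPred_eq, mem_iInter,
      mem_compl_iff]
    constructor
    · intro h
      by_cases hne : {i | P i ω}.Nonempty
      · left
        have h1 := Nat.sInf_mem hne
        rw [h] at h1
        exact ⟨h1, fun m hm => Nat.notMem_of_lt_sInf (h ▸ hm)⟩
      · right
        rw [not_nonempty_iff_eq_empty] at hne
        rw [hne, Nat.sInf_empty] at h
        rw [if_pos h.symm]
        simp only [mem_iInter, mem_compl_iff, mem_ofPred_eq]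
        intro m hm
        have : m ∈ {i | P i ω} := hm
        simp [hne] at this
    · rintro (⟨h1, h2⟩ | h)
      · refine le_antisymm (Nat.sInf_le h1) ?_
        by_contra! hc
        have h3 : sInf {i | P i ω} ∈ {i | P i ω} := Nat.sInf_mem ⟨n, h1⟩
        exact h2 _ hc h3
      · split_ifs at h with hn
        · have : {i | P i ω} = ∅ := by
            ext m
            simp only [mem_iInter, mem_compl_iff, mem_ofPred_eq] at h
            simpa using h m
          rw [this, Nat.sInf_empty, hn]
        · exact h.elim
  rw [this]
  refine ((hP n).inter (MeasurableSet.iInter fun m => MeasurableSet.iInter fun _ =>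
    (hP m).compl)).union ?_
  split_ifs
  · exact MeasurableSet.iInter fun m => (hP m).compl
  · exact MeasurableSet.empty

theorem measurable_servingIndex (hX : ∀ i, Measurable (X i)) (hA : MeasurableSet A) :
    Measurable (servingIndex X A) := by
  refine measurable_sInf_setOf fun i => (hX i hA).inter ?_
  have : {ω | ∀ j, X j ω ∈ A → ‖X i ω‖ ≤ ‖X j ω‖} =
      ⋂ j, ((X j ⁻¹' A)ᶜ ∪ {ω | ‖X i ω‖ ≤ ‖X j ω‖}) := by
    ext ω; simp [imp_iff_not_or]
  change MeasurableSet {ω | ∀ j, X j ω ∈ A → ‖X i ω‖ ≤ ‖X j ω‖}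
  rw [this]
  exact MeasurableSet.iInter fun j => (hX j hA).compl.union
    (measurableSet_le (hX i).norm (hX j).norm)

theorem measurable_servingDistance (hX : ∀ i, Measurable (X i)) (hA : MeasurableSet A) :
    Measurable (servingDistance X A) := by
  have : Measurable (Function.uncurry fun (n : ℕ) ω => ‖X n ω‖) :=
    measurable_from_prod_countable_right fun n => (hX n).norm
  have h2 : Measurable fun ω => (servingIndex X A ω, ω) :=
    (measurable_servingIndex hX hA).prodMk measurable_id
  have h3 : servingDistance X A =
      (Function.uncurry fun (n : ℕ) ω => ‖X n ω‖) ∘ fun ω => (servingIndex X A ω, ω) := rfl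
  rw [h3]
  exact this.comp h2

theorem measurableSet_nonemptyEvent (hX : ∀ i, Measurable (X i)) (hA : MeasurableSet A) :
    MeasurableSet (nonemptyEvent X A) := by
  have : nonemptyEvent X A = ⋃ i, X i ⁻¹' A := by ext ω; simp [nonemptyEvent]
  rw [this]
  exact MeasurableSet.iUnion fun i => hX i hA

theorem measurable_interfererGain (α : ℝ) (hX : ∀ i, Measurable (X i)) (hA : MeasurableSet A)
    (i : ℕ) : Measurable (interfererGain α X A i) := by
  refine Measurable.ite ((hX i hA).inter ?_) ((hX i).norm.pow_const _) measurable_const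
  have h1 : {ω | i ≠ servingIndex X A ω} = (servingIndex X A ⁻¹' {i})ᶜ := by
    ext ω
    exact ne_comm
  change MeasurableSet {ω | i ≠ servingIndex X A ω}
  rw [h1]
  exact (measurable_servingIndex hX hA (measurableSet_singleton i)).compl

end Measurability

/-- Finiteness and nonemptiness make the set of minimisers nonempty, so that its `sInf` belongs to
it and is not the default `0`. -/
theorem servingIndex_spec {X : ℕ → Ω → Plane} {A : Set Plane} {ω : Ω}
    (hfin : {i | X i ω ∈ A}.Finite) (hne : ω ∈ nonemptyEvent X A) :
    X (servingIndex X A ω) ω ∈ A ∧ ∀ j, X j ω ∈ A → ‖X (servingIndex X A ω) ω‖ ≤ ‖X j ω‖ := by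
  obtain ⟨i, hi, hmin⟩ := hfin.exists_minimalFor (fun i => ‖X i ω‖) _ hne
  have : {i | X i ω ∈ A ∧ ∀ j, X j ω ∈ A → ‖X i ω‖ ≤ ‖X j ω‖}.Nonempty := by
    refine ⟨i, hi, fun j hj => ?_⟩
    by_contra! hc
    exact hc.not_ge (hmin hj hc.le)
  exact Nat.sInf_mem this

/-! ### Poisson counts -/

section Poisson

open scoped NNReal

theorem integral_pow_poissonMeasure (m : ℝ≥0) (c : ℝ) :
    ∫ k, c ^ k ∂(poissonMeasure m) = Real.exp (-(m * (1 - c))) := by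
  rw [integral_poissonMeasure]
  have h := (NormedSpace.expSeries_div_hasSum_exp (𝔸 := ℝ) ((m : ℝ) * c)).mul_left (Real.exp (-m))
  rw [← Real.exp_eq_exp_ℝ, ← Real.exp_add] at h
  rw [show -((m : ℝ) * (1 - c)) = -m + m * c by ring, ← h.tsum_eq]
  refine tsum_congr fun n => ?_
  rw [mul_pow, smul_eq_mul]
  ring

/-- The probability is `1 - e^(-m) (1 + m)`, and `e^(-m) ≥ 1 - m`. -/
theorem poissonMeasure_real_two_le (m : ℝ≥0) :
    (poissonMeasure m).real {k | 2 ≤ k} ≤ (m : ℝ) ^ 2 := by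
  have h1 : {k : ℕ | 2 ≤ k} = ({0} ∪ {1})ᶜ := by ext k; simp; omega
  rw [h1, probReal_compl_eq_one_sub (by measurability), measureReal_union (by simp) (by measurability),
    poissonMeasure_real_singleton, poissonMeasure_real_singleton]
  have := Real.add_one_le_exp (-(m : ℝ))
  simp
  nlinarith [m.2]

variable [MeasurableSpace Ω] {μ : Measure Ω} {lam : ℝ} {X : ℕ → Ω → Plane} {B : Set Plane}

/-- The push-forward by a map that is not a.e.-measurable is `0` by convention, whereas here it is a
probability measure. -/
theorem IsHPPP.aemeasurable_pointCount (hX : IsHPPP lam X μ) (hB : MeasurableSet B)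
    (hb : Bornology.IsBounded B) : AEMeasurable (pointCount X B) μ := by
  refine AEMeasurable.of_map_ne_zero ?_
  rw [hX.law_count B hB hb]
  exact IsProbabilityMeasure.ne_zero _

theorem IsHPPP.integral_pointCount (hX : IsHPPP lam X μ) (hB : MeasurableSet B)
    (hb : Bornology.IsBounded B) (φ : ℕ∞ → ℝ) :
    ∫ ω, φ (pointCount X B ω) ∂μ =
      ∫ k : ℕ, φ k ∂(poissonMeasure (Real.toNNReal (lam * volume.real B))) := by
  rw [← integral_map (f := φ) (hX.aemeasurable_pointCount hB hb)
      Measurable.of_discrete.aestronglyMeasurable, hX.law_count B hB hb,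
    integral_map Measurable.of_discrete.aemeasurable Measurable.of_discrete.aestronglyMeasurable]

theorem IsHPPP.measure_pointCount (hX : IsHPPP lam X μ) (hB : MeasurableSet B)
    (hb : Bornology.IsBounded B) (s : Set ℕ∞) :
    μ {ω | pointCount X B ω ∈ s} =
      poissonMeasure (Real.toNNReal (lam * volume.real B)) {k : ℕ | (k : ℕ∞) ∈ s} := by
  have h := DFunLike.congr_fun (hX.law_count B hB hb) s
  rw [Measure.map_apply_of_aemeasurable (hX.aemeasurable_pointCount hB hb) .of_discrete,
    Measure.map_apply .of_discrete .of_discrete] at h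
  exact h

/-- The law of the count is carried by `ℕ` and gives no mass to `⊤`. -/
theorem IsHPPP.ae_finite (hX : IsHPPP lam X μ) (hB : MeasurableSet B)
    (hb : Bornology.IsBounded B) : ∀ᵐ ω ∂μ, {i | X i ω ∈ B}.Finite := by
  have h := hX.measure_pointCount hB hb {⊤}
  have h2 : {k : ℕ | (k : ℕ∞) ∈ ({⊤} : Set ℕ∞)} = ∅ := by ext k; simp
  rw [h2, measure_empty] at h
  refine (measure_eq_zero_iff_ae_notMem.1 h).mono fun ω hω => ?_
  rw [← encard_ne_top_iff]
  exact hω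

theorem IsHPPP.ae_notMem_of_volume_eq_zero (hX : IsHPPP lam X μ) (hB : MeasurableSet B)
    (hb : Bornology.IsBounded B) (h0 : volume B = 0) : ∀ᵐ ω ∂μ, ∀ i, X i ω ∉ B := by
  have h := hX.measure_pointCount hB hb {0}ᶜ
  have hz : volume.real B = 0 := by simp [Measure.real, h0]
  have h3 : poissonMeasure 0 {k : ℕ | (k : ℕ∞) ∈ ({0}ᶜ : Set ℕ∞)} = 0 := by
    have : {k : ℕ | (k : ℕ∞) ∈ ({0}ᶜ : Set ℕ∞)} = {0}ᶜ := by ext k; simp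
    rw [this, prob_compl_eq_zero_iff (by measurability), poissonMeasure_singleton]
    simp
  rw [hz, mul_zero, Real.toNNReal_zero, h3] at h
  refine (measure_eq_zero_iff_ae_notMem.1 h).mono fun ω hω i hi => hω ?_
  intro h4
  have : {i : ℕ | X i ω ∈ B} = ∅ := encard_eq_zero.1 h4
  have h5 : i ∈ {i : ℕ | X i ω ∈ B} := hi
  simp [this] at h5

theorem IsHPPP.measure_two_le_pointCount (hX : IsHPPP lam X μ) (hlam : 0 ≤ lam)
    (hB : MeasurableSet B) (hb : Bornology.IsBounded B) :
    μ {ω | 2 ≤ pointCount X B ω} ≤ ENNReal.ofReal ((lam * volume.real B) ^ 2) := by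
  have h := hX.measure_pointCount hB hb {k | 2 ≤ k}
  have h2 := poissonMeasure_real_two_le (Real.toNNReal (lam * volume.real B))
  rw [Real.coe_toNNReal _ (by positivity)] at h2
  change μ {ω | pointCount X B ω ∈ {k | 2 ≤ k}} ≤ _
  rw [h, ← ofReal_measureReal]
  refine ENNReal.ofReal_le_ofReal (le_trans (le_of_eq ?_) h2)
  congr 1
  ext k
  simp only [mem_ofPred_eq]
  norm_cast

end Poisson

end SingleCluster

/-! ### Integrating out the fading -/

namespace SingleCluster

open Filter Topology

variable {Ω : Type*}

/-- The clamp `max x 0` is invisible to the exponential law, but keeps the integrand in `[0, 1]` for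
every real `x`; this supplies the bound for Fubini below. -/
theorem integral_exp_neg_mul_expMeasure {t : ℝ} (ht : 0 ≤ t) :
    ∫ x, Real.exp (-(t * max x 0)) ∂(expMeasure 1) = (1 + t)⁻¹ := by
  have hpdf : ∀ x, exponentialPDF 1 x < ⊤ := fun x => ENNReal.ofReal_lt_top
  have hmeas : Measurable (exponentialPDF 1) := (measurable_exponentialPDFReal 1).ennreal_ofReal
  change ∫ x, _ ∂(volume.withDensity (exponentialPDF 1)) = _
  rw [integral_withDensity_eq_integral_toReal_smul hmeas (Eventually.of_forall hpdf)]
  have h1 : ∀ x, (exponentialPDF 1 x).toReal • Real.exp (-(t * max x 0)) =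
      (Ici (0 : ℝ)).indicator (fun x => Real.exp (-(1 + t) * x)) x := by
    intro x
    by_cases hx : 0 ≤ x
    · rw [indicator_of_mem (mem_Ici.2 hx), exponentialPDF_of_nonneg hx,
        ENNReal.toReal_ofReal (by positivity), max_eq_left hx, smul_eq_mul, one_mul, ← Real.exp_add]
      congr 1; ring
    · rw [indicator_of_notMem (by simpa using hx), exponentialPDF_of_neg (not_le.1 hx)]
      simp
  simp only [h1]
  rw [integral_indicator measurableSet_Ici, integral_Ici_eq_integral_Ioi,
    integral_exp_mul_Ioi (by linarith), mul_zero, Real.exp_zero, neg_div_neg_eq, one_div]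

theorem ae_nonneg_expMeasure : ∀ᵐ x ∂(expMeasure 1), 0 ≤ x := by
  have h1 : expMeasure 1 (Iio 0) = 0 := by
    change volume.withDensity (exponentialPDF 1) (Iio 0) = 0
    rw [withDensity_apply _ measurableSet_Iio]
    exact lintegral_exponentialPDF_of_nonpos le_rfl
  refine (measure_eq_zero_iff_ae_notMem.1 h1).mono fun x hx => ?_
  simpa using hx

variable [MeasurableSpace Ω] {μ : Measure Ω} {X : ℕ → Ω → Plane} {h : ℕ → Ω → ℝ}

theorem IsRayleighFading.ae_nonneg (hh : IsRayleighFading X h μ) :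
    ∀ᵐ ω ∂μ, ∀ i, 0 ≤ h i ω := by
  refine ae_all_iff.2 fun i => ?_
  refine ae_of_ae_map (hh.measurable i).aemeasurable ?_
  rw [hh.law i]
  exact ae_nonneg_expMeasure

theorem IsRayleighFading.integral_prod_exp [IsProbabilityMeasure μ] (hh : IsRayleighFading X h μ)
    {n : ℕ} {t : ℕ → ℝ} (ht : ∀ i, 0 ≤ t i) :
    ∫ ω, ∏ i ∈ Finset.range n, Real.exp (-(t i * max (h i ω) 0)) ∂μ =
      ∏ i ∈ Finset.range n, (1 + t i)⁻¹ := by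
  have hind : iIndepFun (fun i : Fin n => h i) μ := hh.iIndep.precomp Fin.val_injective
  have := hind.integral_fun_prod_comp (X := fun i : Fin n => h i) (f := fun i x => Real.exp (-(t i * max x 0)))
    (fun i => (hh.measurable i).aemeasurable)
    (fun i => (by fun_prop : Measurable _).aestronglyMeasurable)
  simp only [← Fin.prod_univ_eq_prod_range (fun i => Real.exp (-(t i * max (h i _) 0))) n]
  rw [this, ← Fin.prod_univ_eq_prod_range (fun i => (1 + t i)⁻¹) n]
  refine Finset.prod_congr rfl fun i _ => ?_
  rw [← integral_map (f := fun x => Real.exp (-(t i * max x 0))) (hh.measurable i).aemeasurable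
    (by fun_prop : Measurable _).aestronglyMeasurable, hh.law i,
    integral_exp_neg_mul_expMeasure (ht i)]

/-- Averaging the exponential of a weighted sum of the gains, given the point process. -/
theorem IsRayleighFading.integral_mul_exp_sum [IsProbabilityMeasure μ]
    (hh : IsRayleighFading X h μ) (hX : ∀ i, Measurable (X i)) {s : ℝ} (hs : 0 < s)
    {a : ℕ → (ℕ → Plane) → ℝ} (ham : ∀ i, Measurable (a i)) (ha : ∀ i x, 0 ≤ a i x)
    {u : (ℕ → Plane) → ℝ} (hu : Measurable u) {C : ℝ} (hC : ∀ x, |u x| ≤ C) (n : ℕ) :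
    ∫ ω, u (fun i => X i ω) * Real.exp (-s * ∑ i ∈ Finset.range n,
        h i ω * a i (fun i => X i ω)) ∂μ =
      ∫ ω, u (fun i => X i ω) *
        ∏ i ∈ Finset.range n, (1 + s * a i (fun i => X i ω))⁻¹ ∂μ := by
  set Y : Ω → ℕ → Plane := fun ω i => X i ω
  set H : Ω → ℕ → ℝ := fun ω i => h i ω
  have hY : Measurable Y := measurable_pi_lambda _ hX
  have hH : Measurable H := measurable_pi_lambda _ hh.measurable
  have := Measure.isProbabilityMeasure_map (μ := μ) hY.aemeasurable
  have := Measure.isProbabilityMeasure_map (μ := μ) hH.aemeasurable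
  set F : (ℕ → Plane) × (ℕ → ℝ) → ℝ := fun p =>
    u p.1 * ∏ i ∈ Finset.range n, Real.exp (-(s * a i p.1 * max (p.2 i) 0)) with hF
  have hFm : Measurable F := by
    refine (hu.comp measurable_fst).mul (Finset.measurable_fun_prod _ fun i _ => ?_)
    have h1 : Measurable fun p : (ℕ → Plane) × (ℕ → ℝ) => p.2 i :=
      (measurable_pi_apply i).comp measurable_snd
    have h2 : Measurable fun p : (ℕ → Plane) × (ℕ → ℝ) => a i p.1 := (ham i).comp measurable_fst
    fun_prop
  -- Independence turns the expectation into an iterated integral, the gains being integrated with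
  -- the configuration frozen.
  have hjoint : μ.map (fun ω => (Y ω, H ω)) = (μ.map Y).prod (μ.map H) :=
    (indepFun_iff_map_prod_eq_prod_map_map hY.aemeasurable hH.aemeasurable).1 hh.indep_points
  have hFint : Integrable F ((μ.map Y).prod (μ.map H)) := by
    refine Integrable.of_bound hFm.aestronglyMeasurable C (Eventually.of_forall fun p => ?_)
    rw [norm_mul, Real.norm_eq_abs, Real.norm_eq_abs, abs_of_nonneg
      (Finset.prod_nonneg fun i _ => (Real.exp_pos _).le)]
    refine (mul_le_of_le_one_right (abs_nonneg _) (Finset.prod_le_one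
      (fun i _ => (Real.exp_pos _).le) fun i _ => ?_)).trans (hC _)
    rw [Real.exp_le_one_iff, neg_nonpos]
    exact mul_nonneg (mul_nonneg hs.le (ha _ _)) (le_max_right _ _)
  have e1 : ∫ ω, u (Y ω) * Real.exp (-s * ∑ i ∈ Finset.range n, h i ω * a i (Y ω)) ∂μ =
      ∫ ω, F (Y ω, H ω) ∂μ := by
    refine integral_congr_ae (hh.ae_nonneg.mono fun ω hω => ?_)
    simp only [hF, H]
    rw [← Real.exp_sum, Finset.mul_sum]
    congr 3
    ext i
    rw [max_eq_left (hω i)]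
    ring
  rw [e1, ← integral_map (f := F) (hY.prodMk hH).aemeasurable hFm.aestronglyMeasurable, hjoint,
    integral_prod _ hFint]
  have e2 : ∀ x, ∫ y, F (x, y) ∂(μ.map H) =
      u x * ∏ i ∈ Finset.range n, (1 + s * a i x)⁻¹ := by
    intro x
    rw [integral_map (f := fun y => F (x, y)) hH.aemeasurable
      (hFm.comp measurable_prodMk_left).aestronglyMeasurable]
    simp only [hF, H]
    rw [integral_const_mul, hh.integral_prod_exp fun i => mul_nonneg hs.le (ha i x)]
  simp only [e2]
  rw [integral_map hY.aemeasurable]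
  exact (hu.mul (Finset.measurable_fun_prod _ fun i _ =>
    (measurable_const.add ((ham i).const_mul s)).inv)).aestronglyMeasurable

end SingleCluster

/-! ### Annular shells and the first occupied one -/

namespace SingleCluster

open Filter Topology

/-- The index of the cell of the grid of mesh `1 / (n + 1)` containing the radius `ρ`. -/
noncomputable def radialCell (n : ℕ) (ρ : ℝ) : ℕ := ⌈ρ * (n + 1)⌉₊

/-- The outer radius of the `k`-th cell of the grid of mesh `1 / (n + 1)`. -/
noncomputable def gridRadius (n k : ℕ) : ℝ := k / (n + 1)

/-- The points of `A` whose norm lies in the `k`-th cell. -/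
def shell (A : Set Plane) (n k : ℕ) : Set Plane := {y | y ∈ A ∧ radialCell n ‖y‖ = k}

theorem radialCell_mono (n : ℕ) : Monotone (radialCell n) := fun _ _ h =>
  Nat.ceil_mono (mul_le_mul_of_nonneg_right h (by positivity))

theorem measurable_radialCell (n : ℕ) : Measurable (radialCell n) :=
  Nat.measurable_ceil.comp (measurable_id.mul_const _)

theorem le_gridRadius_radialCell (n : ℕ) (ρ : ℝ) : ρ ≤ gridRadius n (radialCell n ρ) := by
  rw [gridRadius, le_div_iff₀ (by positivity)]
  exact Nat.le_ceil _

theorem gridRadius_radialCell_lt (n : ℕ) {ρ : ℝ} (hρ : 0 ≤ ρ) :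
    gridRadius n (radialCell n ρ) < ρ + 1 / (n + 1) := by
  rw [gridRadius, div_lt_iff₀ (by positivity), add_mul, one_div_mul_cancel (by positivity)]
  exact Nat.ceil_lt_add_one (by positivity)

theorem tendsto_gridRadius_radialCell {ρ : ℝ} (hρ : 0 ≤ ρ) :
    Tendsto (fun n => gridRadius n (radialCell n ρ)) atTop (𝓝 ρ) := by
  refine tendsto_of_tendsto_of_tendsto_of_le_of_le tendsto_const_nhds ?_
    (fun n => le_gridRadius_radialCell n ρ) fun n => (gridRadius_radialCell_lt n hρ).le
  simpa using (tendsto_const_nhds (x := ρ)).add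
    (tendsto_one_div_add_atTop_nhds_zero_nat (𝕜 := ℝ))

theorem eventually_radialCell_lt {r ρ : ℝ} (hr : 0 ≤ r) (h : r < ρ) :
    ∀ᶠ n in atTop, radialCell n r < radialCell n ρ := by
  filter_upwards [(tendsto_gridRadius_radialCell hr).eventually_lt_const h] with n hn
  have h1 := hn.trans_le (le_gridRadius_radialCell n ρ)
  rw [gridRadius, gridRadius, div_lt_div_iff_of_pos_right (by positivity)] at h1
  exact_mod_cast h1

theorem measurableSet_shell {A : Set Plane} (hA : MeasurableSet A) (n k : ℕ) :
    MeasurableSet (shell A n k) :=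
  hA.inter (((measurable_radialCell n).comp measurable_norm) (measurableSet_singleton k))

theorem pairwise_disjoint_shell (A : Set Plane) (n : ℕ) :
    Pairwise (Function.onFun Disjoint (shell A n)) := fun _ _ hij =>
  Set.disjoint_left.2 fun _ hx hy => hij (hx.2.symm.trans hy.2)

theorem isBounded_shell {A : Set Plane} (hb : Bornology.IsBounded A) (n k : ℕ) :
    Bornology.IsBounded (shell A n k) := hb.subset fun _ hy => hy.1

theorem radialCell_le {A : Set Plane} {M : ℝ} (hM : ∀ y ∈ A, ‖y‖ ≤ M) (n : ℕ) {y : Plane}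
    (hy : y ∈ A) : radialCell n ‖y‖ < radialCell n M + 1 :=
  Nat.lt_succ_of_le (radialCell_mono n (hM y hy))

/-- For `k ≥ 1` the shell lies in an annulus, and `k² - (k - 1)² ≤ 2k`. Since cells come from a
ceiling, cell `0` contains at most the origin. -/
theorem volume_shell_le (A : Set Plane) (n k : ℕ) :
    volume.real (shell A n k) ≤ Real.pi * (2 * k) / (n + 1) ^ 2 := by
  rcases Nat.eq_zero_or_pos k with rfl | hk
  · have : shell A n 0 ⊆ {0} := by
      intro y hy
      have h1 := Nat.ceil_eq_zero.1 hy.2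
      have h2 : ‖y‖ ≤ 0 := by
        by_contra! hc
        have : 0 < ‖y‖ * ((n : ℝ) + 1) := by positivity
        linarith
      simpa using h2
    have h0 := measureReal_mono (μ := volume) this (by simp)
    simpa [Measure.real] using h0
  · have hsub : shell A n k ⊆ Metric.closedBall 0 (k / (n + 1)) \
        Metric.closedBall 0 ((k - 1) / (n + 1)) := by
      intro y hy
      rw [Set.mem_sdiff, mem_closedBall_zero_iff, mem_closedBall_zero_iff, not_le,
        le_div_iff₀ (by positivity), div_lt_iff₀ (by positivity)]
      have h2 : ⌈‖y‖ * ((n : ℝ) + 1)⌉₊ = k := hy.2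
      rw [Nat.ceil_eq_iff hk.ne'] at h2
      push_cast [Nat.cast_sub hk] at h2
      exact h2.symm
    have hk1 : (1 : ℝ) ≤ k := by exact_mod_cast hk
    have hv : ∀ b : ℝ, 0 ≤ b → volume.real (Metric.closedBall (0 : Plane) b) = b ^ 2 * Real.pi := by
      intro b hb
      rw [Measure.real, EuclideanSpace.volume_closedBall_fin_two]
      simp [ENNReal.toReal_ofReal hb, Real.pi_pos.le]
    have hle : ((k : ℝ) - 1) / (n + 1) ≤ k / (n + 1) := by
      gcongr
      linarith
    refine (measureReal_mono hsub (by
      exact ne_top_of_le_ne_top measure_closedBall_lt_top.ne (measure_mono sdiff_subset))).trans ?_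
    rw [measureReal_sdiff (Metric.closedBall_subset_closedBall hle) measurableSet_closedBall
      measure_closedBall_lt_top.ne, hv _ (by positivity),
      hv _ (div_nonneg (by linarith) (by positivity)), div_pow, div_pow, ← sub_mul, ← sub_div,
      mul_comm, ← mul_div_assoc]
    gcongr
    nlinarith

variable {Ω : Type*} [MeasurableSpace Ω] {μ : Measure Ω} {lam : ℝ} {X : ℕ → Ω → Plane}
  {A : Set Plane}

/-- Almost surely, no two points of the process in a bounded set have the same norm. -/
theorem IsHPPP.ae_norm_injOn (hX : IsHPPP lam X μ) (hlam : 0 ≤ lam) (hA : MeasurableSet A) {M : ℝ}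
    (hM0 : 0 ≤ M) (hM : ∀ y ∈ A, ‖y‖ ≤ M) :
    ∀ᵐ ω ∂μ, ∀ i j, X i ω ∈ A → X j ω ∈ A → ‖X i ω‖ = ‖X j ω‖ → i = j := by
  have hb : Bornology.IsBounded A :=
    Metric.isBounded_closedBall.subset fun y hy => mem_closedBall_zero_iff.2 (hM y hy)
  -- A tie puts two points in one shell. There are at most `(M + 2)(n + 1)` shells, each of area at
  -- most `2π(M + 2)/(n + 1)`, and two points fall in one with probability at most the square of its
  -- mean; the total is `C / (n + 1)`.
  set C : ℝ := (M + 2) * (lam * (Real.pi * (2 * (M + 2)))) ^ 2 with hC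
  have key : ∀ n : ℕ, μ {ω | ¬ ∀ i j, X i ω ∈ A → X j ω ∈ A → ‖X i ω‖ = ‖X j ω‖ → i = j} ≤
      ENNReal.ofReal (C * (1 / ((n : ℝ) + 1))) := by
    intro n
    set N := radialCell n M + 1 with hN
    have hNle : (N : ℝ) ≤ (M + 2) * (n + 1) := by
      have := Nat.ceil_lt_add_one (a := M * ((n : ℝ) + 1)) (by positivity)
      rw [hN, radialCell]
      push_cast
      nlinarith [n.cast_nonneg (α := ℝ)]
    calc _ ≤ μ (⋃ k ∈ Finset.range N, {ω | 2 ≤ pointCount X (shell A n k) ω}) := by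
          refine measure_mono fun ω hω => ?_
          simp only [mem_ofPred_eq, not_forall] at hω
          obtain ⟨i, j, hi, hj, hij, hne⟩ := hω
          simp only [mem_iUnion]
          refine ⟨radialCell n ‖X i ω‖, Finset.mem_range.2 (radialCell_le hM n hi), ?_⟩
          have : ({i, j} : Set ℕ) ⊆ {l | X l ω ∈ shell A n (radialCell n ‖X i ω‖)} := by
            rintro l (rfl | rfl)
            · exact ⟨hi, rfl⟩
            · exact ⟨hj, by rw [hij]⟩
          have h2 := encard_le_encard this
          rw [encard_pair hne] at h2
          exact h2
      _ ≤ ∑ k ∈ Finset.range N, μ {ω | 2 ≤ pointCount X (shell A n k) ω} :=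
          measure_biUnion_finset_le _ _
      _ ≤ ∑ k ∈ Finset.range N,
          ENNReal.ofReal ((lam * (Real.pi * (2 * (M + 2)) / (n + 1))) ^ 2) := by
          refine Finset.sum_le_sum fun k hk => ?_
          refine (hX.measure_two_le_pointCount hlam (measurableSet_shell hA n k)
            (isBounded_shell hb n k)).trans (ENNReal.ofReal_le_ofReal ?_)
          have h1 := volume_shell_le A n k
          have h2 : Real.pi * (2 * k) / ((n : ℝ) + 1) ^ 2 ≤
              Real.pi * (2 * (M + 2)) / (n + 1) := by
            rw [div_le_div_iff₀ (by positivity) (by positivity)]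
            have hk' : (k : ℝ) ≤ (M + 2) * (n + 1) :=
              (Nat.cast_le.2 (Finset.mem_range.1 hk).le).trans hNle
            have : Real.pi * (2 * k) ≤ Real.pi * (2 * ((M + 2) * (n + 1))) := by gcongr
            calc Real.pi * (2 * k) * ((n : ℝ) + 1) ≤
                  Real.pi * (2 * ((M + 2) * (n + 1))) * (n + 1) := by gcongr
              _ = _ := by ring
          have h3 := h1.trans h2
          gcongr
      _ = ENNReal.ofReal (N * (lam * (Real.pi * (2 * (M + 2)) / (n + 1))) ^ 2) := by
          rw [Finset.sum_const, Finset.card_range, nsmul_eq_mul,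
            ENNReal.ofReal_mul (Nat.cast_nonneg _), ENNReal.ofReal_natCast]
      _ ≤ _ := by
          refine ENNReal.ofReal_le_ofReal ?_
          calc _ ≤ (M + 2) * ((n : ℝ) + 1) * (lam * (Real.pi * (2 * (M + 2)) / (n + 1))) ^ 2 := by
                gcongr
            _ = _ := by rw [hC]; field_simp
  refine le_antisymm ?_ bot_le
  change μ {ω | ¬ ∀ i j, X i ω ∈ A → X j ω ∈ A → ‖X i ω‖ = ‖X j ω‖ → i = j} ≤ 0
  have h := (tendsto_one_div_add_atTop_nhds_zero_nat (𝕜 := ℝ)).const_mul C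
  rw [mul_zero] at h
  have h2 := ENNReal.tendsto_ofReal h
  rw [ENNReal.ofReal_zero] at h2
  exact ge_of_tendsto' h2 key

/-- The weight of the count `x` of the `k`-th cell in the description of the event that the `j`-th
cell is the first nonempty one, with a factor `c k` for every point in a later cell. -/
noncomputable def firstCellWeight (c : ℕ → ℝ) (j k : ℕ) (x : ℕ∞) : ℝ :=
  if k < j then (if x = 0 then 1 else 0) else if k = j then (if x = 0 then 0 else 1)
  else c k ^ x.toNat

theorem firstCellWeight_mem_Icc {c : ℕ → ℝ} (hc : ∀ k, c k ∈ Icc (0 : ℝ) 1) (j k : ℕ) (x : ℕ∞) :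
    firstCellWeight c j k x ∈ Icc (0 : ℝ) 1 := by
  rw [firstCellWeight]
  split_ifs
  any_goals simp
  exact ⟨pow_nonneg (hc k).1 _, pow_le_one₀ (hc k).1 (hc k).2⟩

theorem abs_prod_firstCellWeight_le {c : ℕ → ℝ} (hc : ∀ k, c k ∈ Icc (0 : ℝ) 1) (j : ℕ) {N : ℕ}
    (x : Fin N → ℕ∞) : |∏ k : Fin N, firstCellWeight c j k (x k)| ≤ 1 := by
  have h := fun k : Fin N => firstCellWeight_mem_Icc hc j k (x k)
  rw [abs_of_nonneg (Finset.prod_nonneg fun k _ => (h k).1)]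
  exact Finset.prod_le_one (fun k _ => (h k).1) fun k _ => (h k).2

/-- Independence of the counts factorises both sides. Factors with `k ≤ j` do not involve `c`; those
with `k > j` are Poisson generating functions, equal to `1` when `c = 1`. -/
theorem IsHPPP.integral_firstCellWeight (hX : IsHPPP lam X μ) (hlam : 0 ≤ lam) {N : ℕ}
    {B : ℕ → Set Plane} (hB : ∀ k, MeasurableSet (B k)) (hb : ∀ k, Bornology.IsBounded (B k))
    (hd : Pairwise (Function.onFun Disjoint B)) (c : ℕ → ℝ) (j : ℕ) :
    ∫ ω, ∏ k : Fin N, firstCellWeight c j k (pointCount X (B k) ω) ∂μ =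
      (∫ ω, ∏ k : Fin N, firstCellWeight (fun _ => 1) j k (pointCount X (B k) ω) ∂μ) *
        Real.exp (-(lam * ∑ k : Fin N, if j < k then volume.real (B k) * (1 - c k) else 0)) := by
  have hind : iIndepFun (fun k : Fin N => pointCount X (B k)) μ :=
    hX.indep_count N (fun k => B k) (fun k => ⟨hB k, hb k⟩)
      fun k l hkl => hd (fun h => hkl (Fin.ext h))
  have hprod : ∀ c : ℕ → ℝ,
      ∫ ω, ∏ k : Fin N, firstCellWeight c j k (pointCount X (B k) ω) ∂μ =
        ∏ k : Fin N, ∫ ω, firstCellWeight c j k (pointCount X (B k) ω) ∂μ := fun c =>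
    hind.integral_fun_prod_comp (X := fun k : Fin N => pointCount X (B k))
      (f := fun k => firstCellWeight c j k)
      (fun k => hX.aemeasurable_pointCount (hB k) (hb k))
      (fun k => Measurable.of_discrete.aestronglyMeasurable)
  rw [hprod, hprod, Finset.mul_sum, ← Finset.sum_neg_distrib, Real.exp_sum,
    ← Finset.prod_mul_distrib]
  refine Finset.prod_congr rfl fun k _ => ?_
  rcases lt_or_ge j (k : ℕ) with h | h
  · rw [hX.integral_pointCount (hB k) (hb k), hX.integral_pointCount (hB k) (hb k)]
    simp only [firstCellWeight, h.not_gt, h.ne', if_false, ENat.toNat_natCast, one_pow, h, if_true]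
    rw [integral_pow_poissonMeasure, Real.coe_toNNReal _ (mul_nonneg hlam measureReal_nonneg)]
    simp [mul_assoc]
  · simp only [firstCellWeight, h.not_gt, if_false, mul_zero, neg_zero, Real.exp_zero, mul_one]
    refine integral_congr_ae (Eventually.of_forall fun ω => ?_)
    simp only
    split_ifs <;> first | rfl | omega

end SingleCluster

/-! ### Discretised factors and their limits -/

namespace SingleCluster

open Filter Topology

theorem fadingFactor_mem_Icc (α : ℝ) {s ρ : ℝ} (hs : 0 < s) (hρ : 0 ≤ ρ) :
    fadingFactor α s ρ ∈ Icc (0 : ℝ) 1 := by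
  have : 0 ≤ s * ρ ^ (-α) := mul_nonneg hs.le (Real.rpow_nonneg hρ _)
  exact ⟨inv_nonneg.2 (by linarith), inv_le_one_of_one_le₀ (by linarith)⟩

theorem continuousAt_fadingFactor (α : ℝ) {s ρ : ℝ} (hs : 0 < s) (hρ : 0 < ρ) :
    ContinuousAt (fadingFactor α s) ρ := by
  have h0 : 0 < ρ ^ (-α) := Real.rpow_pos_of_pos hρ _
  exact (continuousAt_const.add (continuousAt_const.mul
    (Real.continuousAt_rpow_const _ _ (Or.inl hρ.ne')))).inv₀ (add_pos one_pos (mul_pos hs h0)).ne'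

theorem measurable_fadingFactor (α s : ℝ) : Measurable (fadingFactor α s) := by
  unfold fadingFactor; fun_prop

/-- The factor contributed by a point at distance `ρ` if only points beyond `r` count. -/
noncomputable def tailFactor (α s r ρ : ℝ) : ℝ := if r < ρ then fadingFactor α s ρ else 1

/-- The factor `tailFactor` with all distances rounded up to the grid. -/
noncomputable def gridTailFactor (α s : ℝ) (n j : ℕ) (ρ : ℝ) : ℝ :=
  if j < radialCell n ρ then fadingFactor α s (gridRadius n (radialCell n ρ)) else 1

theorem gridRadius_nonneg (n k : ℕ) : 0 ≤ gridRadius n k := by unfold gridRadius; positivity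

theorem tailFactor_mem_Icc (α r : ℝ) {s ρ : ℝ} (hs : 0 < s) (hρ : 0 ≤ ρ) :
    tailFactor α s r ρ ∈ Icc (0 : ℝ) 1 := by
  rw [tailFactor]
  split_ifs
  exacts [fadingFactor_mem_Icc α hs hρ, ⟨zero_le_one, le_rfl⟩]

theorem gridTailFactor_mem_Icc (α : ℝ) {s : ℝ} (ρ : ℝ) (hs : 0 < s) (n j : ℕ) :
    gridTailFactor α s n j ρ ∈ Icc (0 : ℝ) 1 := by
  rw [gridTailFactor]
  split_ifs
  exacts [fadingFactor_mem_Icc α hs (gridRadius_nonneg _ _), ⟨zero_le_one, le_rfl⟩]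

theorem measurable_tailFactor (α s r : ℝ) : Measurable (tailFactor α s r) :=
  Measurable.ite measurableSet_Ioi (measurable_fadingFactor α s) measurable_const

theorem measurable_gridTailFactor (α s : ℝ) (n j : ℕ) : Measurable (gridTailFactor α s n j) := by
  have h : Measurable fun k : ℕ => if j < k then fadingFactor α s (gridRadius n k) else 1 :=
    Measurable.of_discrete
  exact h.comp (measurable_radialCell n)

/-- A point strictly beyond `r` is eventually in a strictly later cell, and its rounded distance
converges to `ρ > 0`, where the factor is continuous. A point with `ρ ≤ r` is never in a later cell.
-/
theorem tendsto_gridTailFactor (α : ℝ) {s r ρ : ℝ} (hs : 0 < s) (hr : 0 ≤ r) :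
    Tendsto (fun n => gridTailFactor α s n (radialCell n r) ρ) atTop (𝓝 (tailFactor α s r ρ)) := by
  rcases lt_or_ge r ρ with h | h
  · rw [tailFactor, if_pos h]
    have h0 : 0 < ρ := hr.trans_lt h
    refine ((continuousAt_fadingFactor α hs h0).tendsto.comp
      (tendsto_gridRadius_radialCell h0.le)).congr' ?_
    filter_upwards [eventually_radialCell_lt hr h] with n hn
    rw [gridTailFactor, if_pos hn]
    rfl
  · rw [tailFactor, if_neg h.not_gt]
    refine tendsto_const_nhds.congr fun n => ?_
    rw [gridTailFactor, if_neg (radialCell_mono n h).not_gt]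

theorem outerIntegral_eq (α s r : ℝ) {A : Set Plane} (hA : MeasurableSet A) :
    outerIntegral α s A r = ∫ y in A, (1 - tailFactor α s r ‖y‖) := by
  rw [outerIntegral, ← integral_indicator hA]
  congr 1
  ext y
  simp only [indicator, mem_ofPred_eq, tailFactor]
  by_cases h1 : y ∈ A <;> by_cases h2 : r < ‖y‖ <;> simp [h1, h2]

section DiskIntegrals

variable {A : Set Plane} {M : ℝ}

theorem integrableOn_of_mem_Icc (hM : ∀ y ∈ A, ‖y‖ ≤ M) {f : Plane → ℝ}
    (hf : Measurable f) (h : ∀ y, f y ∈ Icc (0 : ℝ) 1) : IntegrableOn f A := by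
  have hb : volume A < ⊤ := (Metric.isBounded_closedBall.subset
    fun y hy => mem_closedBall_zero_iff.2 (hM y hy)).measure_lt_top
  refine Measure.integrableOn_of_bounded hb.ne hf.aestronglyMeasurable
    (Eventually.of_forall fun y => ?_) (M := 1)
  rw [Real.norm_of_nonneg (h y).1]
  exact (h y).2

theorem tendsto_gridOuterIntegral (α : ℝ) {s r : ℝ} (hs : 0 < s) (hr : 0 ≤ r)
    (hA : MeasurableSet A) (hM : ∀ y ∈ A, ‖y‖ ≤ M) :
    Tendsto (fun n => ∫ y in A, (1 - gridTailFactor α s n (radialCell n r) ‖y‖)) atTop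
      (𝓝 (outerIntegral α s A r)) := by
  rw [outerIntegral_eq α s r hA]
  have hmem : ∀ n (y : Plane), 1 - gridTailFactor α s n (radialCell n r) ‖y‖ ∈ Icc (0 : ℝ) 1 := by
    intro n y
    have := gridTailFactor_mem_Icc α ‖y‖ hs n (radialCell n r)
    exact ⟨by linarith [this.2], by linarith [this.1]⟩
  refine tendsto_integral_of_dominated_convergence (fun _ => 1)
    (fun n => ((measurable_const.sub
      ((measurable_gridTailFactor α s n _).comp measurable_norm)).aestronglyMeasurable))
    (integrableOn_of_mem_Icc hM measurable_const fun _ => by simp) (fun n => ?_) ?_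
  · refine Eventually.of_forall fun y => ?_
    rw [Real.norm_of_nonneg (hmem n y).1]
    exact (hmem n y).2
  · exact Eventually.of_forall fun y => (tendsto_gridTailFactor α hs hr).const_sub 1

/-- The grid factor is constant on each shell, and the shells up to the cell of `M` partition `A`.
-/
theorem sum_volume_shell_eq (α : ℝ) {s : ℝ} (hA : MeasurableSet A)
    (hM : ∀ y ∈ A, ‖y‖ ≤ M) (n j : ℕ) :
    (∑ k : Fin (radialCell n M + 1), if j < k then
      volume.real (shell A n k) * (1 - fadingFactor α s (gridRadius n k)) else 0) =
      ∫ y in A, (1 - gridTailFactor α s n j ‖y‖) := by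
  have hb : Bornology.IsBounded A :=
    Metric.isBounded_closedBall.subset fun y hy => mem_closedBall_zero_iff.2 (hM y hy)
  set w : ℕ → ℝ := fun k => if j < k then 1 - fadingFactor α s (gridRadius n k) else 0 with hw
  have h1 : ∀ k : ℕ, (if j < k then
      volume.real (shell A n k) * (1 - fadingFactor α s (gridRadius n k)) else 0) =
      ∫ y, (shell A n k).indicator (fun _ => w k) y := by
    intro k
    rw [integral_indicator_const _ (measurableSet_shell hA n k), hw, smul_eq_mul]
    simp only [mul_ite, mul_zero]
  simp only [h1]
  rw [← integral_finsetSum, ← integral_indicator hA]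
  · congr 1
    ext y
    by_cases hy : y ∈ A
    · rw [indicator_of_mem hy,
        Fin.sum_univ_eq_sum_range (fun k => (shell A n k).indicator (fun _ => w k) y),
        Finset.sum_eq_single_of_mem (radialCell n ‖y‖) (Finset.mem_range.2 (radialCell_le hM n hy))]
      · rw [indicator_of_mem (show y ∈ shell A n (radialCell n ‖y‖) from ⟨hy, rfl⟩), hw,
          gridTailFactor]
        simp only
        split_ifs <;> simp
      · intro k _ hk
        exact indicator_of_notMem (fun h => hk h.2.symm) _
    · rw [indicator_of_notMem hy]
      exact Finset.sum_eq_zero fun k _ => indicator_of_notMem (fun h => hy h.1) _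
  · intro k _
    refine (integrable_indicator_iff (measurableSet_shell hA n k)).2 ?_
    exact integrableOn_const (isBounded_shell hb n k).measure_lt_top.ne

end DiskIntegrals

section Configuration

variable {Ω : Type*} {X : ℕ → Ω → Plane} {A : Set Plane} {ω : Ω} {M : ℝ}

theorem pointCount_shell_eq_card (hfin : {i | X i ω ∈ A}.Finite) (n k : ℕ) :
    pointCount X (shell A n k) ω =
      ((hfin.toFinset.filter fun i => radialCell n ‖X i ω‖ = k).card : ℕ∞) := by
  rw [pointCount, ← encard_coe_eq_coe_finsetCard]
  congr 1
  ext i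
  simp [shell]

theorem prod_firstCellWeight_of_isEmpty {N j : ℕ} (hj : j < N) (c : ℕ → ℝ) (n : ℕ)
    (h : ω ∉ nonemptyEvent X A) :
    ∏ k : Fin N, firstCellWeight c j k (pointCount X (shell A n k) ω) = 0 := by
  refine Finset.prod_eq_zero (Finset.mem_univ ⟨j, hj⟩) ?_
  have : pointCount X (shell A n j) ω = 0 := by
    rw [pointCount, encard_eq_zero]
    ext i
    simp only [mem_ofPred_eq, mem_empty_iff_false, iff_false]
    exact fun hi => h ⟨i, hi.1⟩
  simp [firstCellWeight, this]

/-- Let `J` be the cell of the serving point, the first occupied one. If `j < J`, cell `j` is empty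
but required to be occupied; if `j > J`, cell `J` is occupied but required to be empty. For `j = J`
the product over points is regrouped by cell. -/
theorem prod_firstCellWeight (hfin : {i | X i ω ∈ A}.Finite) (hne : ω ∈ nonemptyEvent X A)
    (hM : ∀ y ∈ A, ‖y‖ ≤ M) (c : ℕ → ℝ) (n j : ℕ) (hj : j < radialCell n M + 1) :
    ∏ k : Fin (radialCell n M + 1), firstCellWeight c j k (pointCount X (shell A n k) ω) =
      if j = radialCell n (servingDistance X A ω) then
        ∏ i ∈ hfin.toFinset, (if radialCell n (servingDistance X A ω) < radialCell n ‖X i ω‖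
          then c (radialCell n ‖X i ω‖) else 1) else 0 := by
  classical
  obtain ⟨hc, hmin⟩ := servingIndex_spec hfin hne
  set i₀ := servingIndex X A ω with hi₀
  set J := radialCell n (servingDistance X A ω) with hJ
  have hJ' : J = radialCell n ‖X i₀ ω‖ := rfl
  have hmem : ∀ {i}, i ∈ hfin.toFinset ↔ X i ω ∈ A := by simp
  have hJle : ∀ i ∈ hfin.toFinset, J ≤ radialCell n ‖X i ω‖ := fun i hi =>
    radialCell_mono n (hmin i (hmem.1 hi))
  have hJN : J < radialCell n M + 1 := radialCell_le hM n hc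
  have hcJ : pointCount X (shell A n J) ω ≠ 0 := by
    rw [pointCount_shell_eq_card hfin]
    simp only [ne_eq, Nat.cast_eq_zero, Finset.card_eq_zero]
    exact Finset.ne_empty_of_mem (Finset.mem_filter.2 ⟨hmem.2 hc, hJ'.symm⟩)
  have hlt : ∀ k < J, pointCount X (shell A n k) ω = 0 := by
    intro k hk
    rw [pointCount_shell_eq_card hfin, Nat.cast_eq_zero, Finset.card_eq_zero,
      Finset.filter_eq_empty_iff]
    intro i hi h
    exact (hJle i hi).not_gt (h ▸ hk)
  rcases lt_trichotomy j J with h | h | h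
  · rw [if_neg h.ne]
    refine Finset.prod_eq_zero (Finset.mem_univ ⟨j, hj⟩) ?_
    simp [firstCellWeight, hlt j h]
  · rw [if_pos h, Fin.prod_univ_eq_prod_range
      (fun k => firstCellWeight c j k (pointCount X (shell A n k) ω)),
      ← Finset.prod_fiberwise_of_maps_to (t := Finset.range (radialCell n M + 1))
        (g := fun i => radialCell n ‖X i ω‖)
        (fun i hi => Finset.mem_range.2 (radialCell_le hM n (hmem.1 hi)))]
    refine Finset.prod_congr rfl fun k _ => ?_
    rw [Finset.prod_congr rfl (g := fun _ => if J < k then c k else 1) (by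
      intro i hi
      rw [(Finset.mem_filter.1 hi).2]), Finset.prod_const, firstCellWeight, h]
    rcases lt_trichotomy k J with h' | h' | h'
    · simp [h', h'.not_gt, hlt k h']
    · simp [h', hcJ]
    · simp [h', h'.not_gt, h'.ne', pointCount_shell_eq_card hfin]
  · rw [if_neg h.ne']
    refine Finset.prod_eq_zero (Finset.mem_univ ⟨J, hJN⟩) ?_
    simp [firstCellWeight, h, hcJ]

end Configuration

end SingleCluster

/-! ### From the discretised identities to the network -/

namespace SingleCluster

open Filter Topology

variable {Ω : Type*}

open Classical in
/-- The product of the factors `tailFactor` over the points in `A`, beyond the serving distance. -/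
noncomputable def tailProduct (α s : ℝ) (X : ℕ → Ω → Plane) (A : Set Plane) (ω : Ω) : ℝ :=
  ∏ᶠ i, if X i ω ∈ A then tailFactor α s (servingDistance X A ω) ‖X i ω‖ else 1

theorem tailProduct_eq {α s : ℝ} {X : ℕ → Ω → Plane} {A : Set Plane} {ω : Ω}
    (hfin : {i | X i ω ∈ A}.Finite) : tailProduct α s X A ω =
      ∏ i ∈ hfin.toFinset, tailFactor α s (servingDistance X A ω) ‖X i ω‖ := by
  classical
  rw [tailProduct, finprod_eq_prod_of_mulSupport_subset (s := hfin.toFinset)]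
  · refine Finset.prod_congr rfl fun i hi => ?_
    rw [if_pos (by simpa using hi)]
  · intro i hi
    by_contra hc
    have : X i ω ∉ A := by simpa using hc
    exact hi (if_neg this)

theorem servingDistance_nonneg (X : ℕ → Ω → Plane) (A : Set Plane) (ω : Ω) :
    0 ≤ servingDistance X A ω := norm_nonneg _

theorem hasSum_interference (α : ℝ) {X : ℕ → Ω → Plane} {A : Set Plane} {ω : Ω}
    (h : ℕ → Ω → ℝ) (hfin : {i | X i ω ∈ A}.Finite) :
    HasSum (fun i => h i ω * interfererGain α X A i ω) (interference α X h A ω) := by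
  rw [interference_eq]
  refine (summable_of_ne_finset_zero (s := hfin.toFinset) fun i hi => ?_).hasSum
  have : X i ω ∉ A := by simpa using hi
  simp [interfererGain, this]

/-- Distinct norms make "not the serving index" the same as "strictly beyond the serving distance";
the serving point itself has factor `1` on both sides. -/
theorem hasProd_tailProduct (α s : ℝ) {X : ℕ → Ω → Plane} {A : Set Plane} {ω : Ω}
    (hfin : {i | X i ω ∈ A}.Finite) (hne : ω ∈ nonemptyEvent X A)
    (hinj : ∀ i j, X i ω ∈ A → X j ω ∈ A → ‖X i ω‖ = ‖X j ω‖ → i = j) :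
    HasProd (fun i => (1 + s * interfererGain α X A i ω)⁻¹) (tailProduct α s X A ω) := by
  obtain ⟨hc, hmin⟩ := servingIndex_spec hfin hne
  have h1 : ∀ i ∉ hfin.toFinset, (1 + s * interfererGain α X A i ω)⁻¹ = 1 := by
    intro i hi
    have : X i ω ∉ A := by simpa using hi
    simp [interfererGain, this]
  have h2 : HasProd (fun i => (1 + s * interfererGain α X A i ω)⁻¹)
      (∏ i ∈ hfin.toFinset, (1 + s * interfererGain α X A i ω)⁻¹) :=
    hasProd_prod_of_ne_finset_one h1
  rw [tailProduct_eq hfin]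
  convert h2 using 1
  refine Finset.prod_congr rfl fun i hi => ?_
  have hi : X i ω ∈ A := by simpa using hi
  by_cases h : i = servingIndex X A ω
  · rw [h]
    simp [tailFactor, servingDistance, interfererGain]
  · have hlt : servingDistance X A ω < ‖X i ω‖ :=
      lt_of_le_of_ne (hmin i hi) fun h' => h (hinj _ _ hi hc h'.symm)
    rw [tailFactor, if_pos hlt, interfererGain, if_pos ⟨hi, h⟩, fadingFactor]

theorem interference_nonneg (α : ℝ) {X : ℕ → Ω → Plane} {h : ℕ → Ω → ℝ} {A : Set Plane}
    {ω : Ω} (hω : ∀ i, 0 ≤ h i ω) :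
    0 ≤ interference α X h A ω := by
  rw [interference_eq]
  exact tsum_nonneg fun i => mul_nonneg (hω i) (interfererGain_nonneg α X A i ω)

variable [MeasurableSpace Ω] {μ : Measure Ω} {lam : ℝ} {X : ℕ → Ω → Plane} {h : ℕ → Ω → ℝ}
  {A : Set Plane} {M : ℝ}

theorem isBounded_of_norm_le (hM : ∀ y ∈ A, ‖y‖ ≤ M) : Bornology.IsBounded A :=
  Metric.isBounded_closedBall.subset fun y hy => mem_closedBall_zero_iff.2 (hM y hy)

theorem aemeasurable_interference (α : ℝ) (hX : IsHPPP lam X μ) (hh : IsRayleighFading X h μ)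
    (hA : MeasurableSet A) (hM : ∀ y ∈ A, ‖y‖ ≤ M) : AEMeasurable (interference α X h A) μ := by
  refine aemeasurable_of_tendsto_metrizable_ae atTop
    (f := fun n ω => ∑ i ∈ Finset.range n, h i ω * interfererGain α X A i ω) (fun n => ?_) ?_
  · exact (Finset.measurable_fun_sum _ fun i _ => (hh.measurable i).mul
      (measurable_interfererGain α hX.measurable hA i)).aemeasurable
  · filter_upwards [hX.ae_finite hA (isBounded_of_norm_le hM)] with ω hω
    exact (hasSum_interference α h hω).tendsto_sum_nat

section Fading

variable [IsProbabilityMeasure μ]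

/-- Integrating out the fading replaces `exp (-s I)` by the product of the fading factors. -/
theorem setIntegral_exp_interference (α : ℝ) {s : ℝ} (hs : 0 < s) (hlam : 0 ≤ lam)
    (hX : IsHPPP lam X μ) (hh : IsRayleighFading X h μ) (hA : MeasurableSet A) (hM0 : 0 ≤ M)
    (hM : ∀ y ∈ A, ‖y‖ ≤ M) {f : ℝ → ℝ} (hf : Continuous f) {C : ℝ} (hC : ∀ x, |f x| ≤ C) :
    ∫ ω in nonemptyEvent X A,
        f (servingDistance X A ω) * Real.exp (-s * interference α X h A ω) ∂μ =
      ∫ ω in nonemptyEvent X A, f (servingDistance X A ω) * tailProduct α s X A ω ∂μ := by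
  have hE := measurableSet_nonemptyEvent hX.measurable hA
  have hC0 : 0 ≤ C := (abs_nonneg _).trans (hC 0)
  -- The coordinate process on configurations: serving distance and gains depend on `ω` only through
  -- the points, so the version for `X` is, by `rfl`, that for `Z` composed with the configuration.
  set Z : ℕ → (ℕ → Plane) → Plane := fun i x => x i
  have hZ : ∀ i, Measurable (Z i) := fun i => measurable_pi_apply i
  set u : (ℕ → Plane) → ℝ :=
    (nonemptyEvent Z A).indicator fun x => f (servingDistance Z A x) with hu
  have hum : Measurable u := (hf.measurable.comp (measurable_servingDistance hZ hA)).indicator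
    (measurableSet_nonemptyEvent hZ hA)
  have huC : ∀ x, |u x| ≤ C := fun x => by
    rw [hu, indicator]
    split_ifs
    · exact hC _
    · simpa using hC0
  have huX : ∀ ω, u (fun i => X i ω) =
      (nonemptyEvent X A).indicator (fun ω => f (servingDistance X A ω)) ω := fun ω => rfl
  have key := hh.integral_mul_exp_sum hX.measurable hs
    (fun i => measurable_interfererGain α hZ hA i)
    (fun i x => interfererGain_nonneg α Z A i x) hum huC
  have hgain : ∀ i ω, interfererGain α Z A i (fun i => X i ω) = interfererGain α X A i ω :=
    fun _ _ => rfl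
  simp only [hgain, huX] at key
  have hindm : Measurable
      ((nonemptyEvent X A).indicator fun ω => f (servingDistance X A ω)) :=
    (hf.measurable.comp (measurable_servingDistance hX.measurable hA)).indicator hE
  have hindC : ∀ ω, |(nonemptyEvent X A).indicator (fun ω => f (servingDistance X A ω)) ω| ≤ C :=
    fun ω => huC fun i => X i ω
  have hfin := hX.ae_finite hA (isBounded_of_norm_le hM)
  have hinj := hX.ae_norm_injOn hlam hA hM0 hM
  have hgm := fun i => measurable_interfererGain α hX.measurable hA i
  -- The identity `key` concerns the first `n` indices; both sides are passed to the limit under the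
  -- bound `C`.
  have l1 := tendsto_integral_of_dominated_convergence (μ := μ) (fun _ => C)
    (F := fun n ω => (nonemptyEvent X A).indicator (fun ω => f (servingDistance X A ω)) ω *
      Real.exp (-s * ∑ i ∈ Finset.range n, h i ω * interfererGain α X A i ω))
    (f := (nonemptyEvent X A).indicator fun ω =>
        f (servingDistance X A ω) * Real.exp (-s * interference α X h A ω))
    (fun n => (hindm.mul ((Finset.measurable_fun_sum _ fun i _ => (hh.measurable i).mul
      (hgm i)).const_mul _).exp).aestronglyMeasurable) (integrable_const C) (fun n => ?_) ?_
  · have l2 := tendsto_integral_of_dominated_convergence (μ := μ) (fun _ => C)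
      (F := fun n ω => (nonemptyEvent X A).indicator (fun ω => f (servingDistance X A ω)) ω *
        ∏ i ∈ Finset.range n, (1 + s * interfererGain α X A i ω)⁻¹)
      (f := (nonemptyEvent X A).indicator fun ω =>
        f (servingDistance X A ω) * tailProduct α s X A ω)
      (fun n => (hindm.mul (Finset.measurable_fun_prod _ fun i _ =>
        (measurable_const.add ((hgm i).const_mul s)).inv)).aestronglyMeasurable)
      (integrable_const C) (fun n => ?_) ?_
    · rw [← integral_indicator hE, ← integral_indicator hE]
      refine tendsto_nhds_unique l1 ?_
      simpa only [key] using l2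
    · refine Eventually.of_forall fun ω => ?_
      have h0 : ∀ i, 1 ≤ 1 + s * interfererGain α X A i ω := fun i => by
        have := mul_nonneg hs.le (interfererGain_nonneg α X A i ω)
        linarith
      rw [norm_mul, Real.norm_eq_abs, Real.norm_eq_abs, abs_of_nonneg (Finset.prod_nonneg
        fun i _ => inv_nonneg.2 (zero_le_one.trans (h0 i)))]
      exact (mul_le_of_le_one_right (abs_nonneg _) (Finset.prod_le_one
        (fun i _ => inv_nonneg.2 (zero_le_one.trans (h0 i)))
        fun i _ => inv_le_one_of_one_le₀ (h0 i))).trans (hindC ω)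
    · filter_upwards [hfin, hinj] with ω h1 h2
      by_cases hne : ω ∈ nonemptyEvent X A
      · simp only [indicator_of_mem hne]
        exact (hasProd_tailProduct α s h1 hne h2).tendsto_prod_nat.const_mul _
      · simp only [indicator_of_notMem hne, zero_mul]
        exact tendsto_const_nhds
  · filter_upwards [hh.ae_nonneg] with ω hω
    rw [norm_mul, Real.norm_eq_abs, Real.norm_eq_abs, Real.abs_exp]
    refine (mul_le_of_le_one_right (abs_nonneg _) ?_).trans (hindC ω)
    rw [Real.exp_le_one_iff]
    have : 0 ≤ ∑ i ∈ Finset.range n, h i ω * interfererGain α X A i ω :=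
      Finset.sum_nonneg fun i _ => mul_nonneg (hω i) (interfererGain_nonneg α X A i ω)
    nlinarith
  · filter_upwards [hfin] with ω h1
    by_cases hne : ω ∈ nonemptyEvent X A
    · simp only [indicator_of_mem hne]
      exact ((Real.continuous_exp.tendsto _).comp
        ((hasSum_interference α h h1).tendsto_sum_nat.const_mul (-s))).const_mul _
    · simp only [indicator_of_notMem hne, zero_mul]
      exact tendsto_const_nhds

end Fading

section Poisson

variable [IsProbabilityMeasure μ]

theorem IsHPPP.integrable_prod_firstCellWeight (hX : IsHPPP lam X μ) (hA : MeasurableSet A)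
    (hM : ∀ y ∈ A, ‖y‖ ≤ M) {c : ℕ → ℝ} (hc : ∀ k, c k ∈ Icc (0 : ℝ) 1) (n j N : ℕ) :
    Integrable (fun ω => ∏ k : Fin N, firstCellWeight c j k (pointCount X (shell A n k) ω)) μ := by
  refine Integrable.of_bound (AEMeasurable.aestronglyMeasurable ?_) 1
    (Eventually.of_forall fun ω => abs_prod_firstCellWeight_le hc j _)
  refine Finset.aemeasurable_fun_prod _ fun k _ => ?_
  exact (Measurable.of_discrete (f := firstCellWeight c j k)).comp_aemeasurable (hX.aemeasurable_pointCount
    (measurableSet_shell hA n k) (isBounded_shell (isBounded_of_norm_le hM) n k))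

/-- Given the serving distance, the points beyond it form a Poisson process, whose Laplace
functional is explicit. -/
theorem setIntegral_tailProduct (α : ℝ) {s : ℝ} (hs : 0 < s) (hlam : 0 ≤ lam)
    (hX : IsHPPP lam X μ) (hA : MeasurableSet A)
    (hM : ∀ y ∈ A, ‖y‖ ≤ M) {f : ℝ → ℝ} (hf : Continuous f) {C : ℝ} (hC : ∀ x, |f x| ≤ C) :
    ∫ ω in nonemptyEvent X A, f (servingDistance X A ω) * tailProduct α s X A ω ∂μ =
      ∫ ω in nonemptyEvent X A, f (servingDistance X A ω) *
        Real.exp (-(lam * outerIntegral α s A (servingDistance X A ω))) ∂μ := by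
  have hE := measurableSet_nonemptyEvent hX.measurable hA
  have hC0 : 0 ≤ C := (abs_nonneg _).trans (hC 0)
  have hb := isBounded_of_norm_le hM
  set N : ℕ → ℕ := fun n => radialCell n M + 1 with hN
  set c : ℕ → ℕ → ℝ := fun n k => fadingFactor α s (gridRadius n k) with hcdef
  have hc : ∀ n k, c n k ∈ Icc (0 : ℝ) 1 := fun n k =>
    fadingFactor_mem_Icc α hs (gridRadius_nonneg n k)
  set I : ℕ → ℕ → ℝ := fun n j => ∫ y in A, (1 - gridTailFactor α s n j ‖y‖) with hI
  have hI0 : ∀ n j, 0 ≤ I n j := fun n j => integral_nonneg fun y => by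
    have := (gridTailFactor_mem_Icc α ‖y‖ hs n j).2
    simp only [Pi.zero_apply]
    linarith
  set J : ℕ → Ω → ℕ := fun n ω => radialCell n (servingDistance X A ω) with hJ
  set P : (ℕ → ℝ) → ℕ → ℕ → Ω → ℝ := fun c n j ω =>
    ∏ k : Fin (N n), firstCellWeight c j k (pointCount X (shell A n k) ω) with hP
  -- `U` and `V` are the grid versions of the two integrands, written as sums over the candidate
  -- first cell `j`; on a nonempty finite configuration only `j = J n ω` survives.
  set U : ℕ → Ω → ℝ := fun n ω =>
    ∑ j ∈ Finset.range (N n), f (gridRadius n j) * P (c n) n j ω with hU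
  set V : ℕ → Ω → ℝ := fun n ω =>
    ∑ j ∈ Finset.range (N n), f (gridRadius n j) * Real.exp (-(lam * I n j)) *
      P (fun _ => 1) n j ω with hV
  have hone : ∀ k : ℕ, (fun _ : ℕ => (1 : ℝ)) k ∈ Icc (0 : ℝ) 1 := fun _ => ⟨zero_le_one, le_rfl⟩
  have hPi : ∀ {c : ℕ → ℝ}, (∀ k, c k ∈ Icc (0 : ℝ) 1) → ∀ n j, Integrable (P c n j) μ :=
    fun hc n j => hX.integrable_prod_firstCellWeight hA hM hc n j _
  -- The identity is already exact at every mesh; only the limit `n → ∞` remains.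
  have hUV : ∀ n, ∫ ω, U n ω ∂μ = ∫ ω, V n ω ∂μ := by
    intro n
    simp only [hU, hV]
    rw [integral_finsetSum _ fun j _ => (hPi (hc n) n j).const_mul _,
      integral_finsetSum _ fun j _ => (hPi hone n j).const_mul _]
    refine Finset.sum_congr rfl fun j _ => ?_
    rw [integral_const_mul, integral_const_mul, hX.integral_firstCellWeight hlam
      (fun k => measurableSet_shell hA n k) (fun k => isBounded_shell hb n k)
      (pairwise_disjoint_shell A n) (c n) j, sum_volume_shell_eq α hA hM n j]
    ring
  have hfin := hX.ae_finite hA hb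
  have hPempty : ∀ {ω}, ω ∉ nonemptyEvent X A → ∀ c n, ∀ j ∈ Finset.range (N n),
      P c n j ω = 0 := fun hω c n j hj =>
    prod_firstCellWeight_of_isEmpty (Finset.mem_range.1 hj) c n hω
  have hJN : ∀ {ω}, {i | X i ω ∈ A}.Finite → ω ∈ nonemptyEvent X A → ∀ n,
      J n ω ∈ Finset.range (N n) := fun h1 h2 n =>
    Finset.mem_range.2 (radialCell_le hM n (servingIndex_spec h1 h2).1)
  have hUeq : ∀ {ω} (h1 : {i | X i ω ∈ A}.Finite), ω ∈ nonemptyEvent X A → ∀ n,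
      U n ω = f (gridRadius n (J n ω)) *
        ∏ i ∈ h1.toFinset, gridTailFactor α s n (J n ω) ‖X i ω‖ := by
    intro ω h1 h2 n
    simp only [hU]
    rw [Finset.sum_eq_single_of_mem _ (hJN h1 h2 n)]
    · simp only [hP]
      rw [prod_firstCellWeight h1 h2 hM _ n _ (Finset.mem_range.1 (hJN h1 h2 n)), if_pos rfl]
      rfl
    · intro j hj hne
      simp only [hP]
      rw [prod_firstCellWeight h1 h2 hM _ n _ (Finset.mem_range.1 hj), if_neg hne, mul_zero]
  have hVeq : ∀ {ω} (h1 : {i | X i ω ∈ A}.Finite), ω ∈ nonemptyEvent X A → ∀ n,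
      V n ω = f (gridRadius n (J n ω)) * Real.exp (-(lam * I n (J n ω))) := by
    intro ω h1 h2 n
    simp only [hV]
    rw [Finset.sum_eq_single_of_mem _ (hJN h1 h2 n)]
    · simp only [hP]
      rw [prod_firstCellWeight h1 h2 hM _ n _ (Finset.mem_range.1 (hJN h1 h2 n)), if_pos rfl]
      simp [hJ]
    · intro j hj hne
      simp only [hP]
      rw [prod_firstCellWeight h1 h2 hM _ n _ (Finset.mem_range.1 hj), if_neg hne, mul_zero]
  have hflim : ∀ ω, Tendsto (fun n => f (gridRadius n (J n ω))) atTop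
      (𝓝 (f (servingDistance X A ω))) := fun ω =>
    (hf.tendsto _).comp (tendsto_gridRadius_radialCell (servingDistance_nonneg X A ω))
  have l1 := tendsto_integral_of_dominated_convergence (μ := μ) (fun _ => C) (F := U)
    (f := (nonemptyEvent X A).indicator fun ω =>
        f (servingDistance X A ω) * tailProduct α s X A ω)
    (fun n => (integrable_finsetSum _ fun j _ => (hPi (hc n) n j).const_mul _).1)
    (integrable_const C) (fun n => ?_) ?_
  · have l2 := tendsto_integral_of_dominated_convergence (μ := μ) (fun _ => C) (F := V)
      (f := (nonemptyEvent X A).indicator fun ω =>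
        f (servingDistance X A ω) *
          Real.exp (-(lam * outerIntegral α s A (servingDistance X A ω))))
      (fun n => (integrable_finsetSum _ fun j _ => (hPi hone n j).const_mul _).1)
      (integrable_const C) (fun n => ?_) ?_
    · rw [← integral_indicator hE, ← integral_indicator hE]
      refine tendsto_nhds_unique l1 ?_
      simpa only [hUV] using l2
    · filter_upwards [hfin] with ω h1
      by_cases hne : ω ∈ nonemptyEvent X A
      · rw [hVeq h1 hne, norm_mul, Real.norm_eq_abs, Real.norm_eq_abs, Real.abs_exp]
        refine (mul_le_of_le_one_right (abs_nonneg _) ?_).trans (hC _)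
        rw [Real.exp_le_one_iff, neg_nonpos]
        exact mul_nonneg hlam (hI0 _ _)
      · rw [hV]
        simp only
        rw [Finset.sum_eq_zero fun j hj => by rw [hPempty hne _ n j hj, mul_zero]]
        simpa using hC0
    · filter_upwards [hfin] with ω h1
      by_cases hne : ω ∈ nonemptyEvent X A
      · simp only [hVeq h1 hne, indicator_of_mem hne]
        refine (hflim ω).mul ((Real.continuous_exp.tendsto _).comp
          ((tendsto_gridOuterIntegral α hs (servingDistance_nonneg X A ω) hA hM).const_mul
            lam).neg)
      · rw [indicator_of_notMem hne]
        refine tendsto_const_nhds.congr fun n => ?_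
        simp only [hV]
        rw [Finset.sum_eq_zero fun j hj => by rw [hPempty hne _ n j hj, mul_zero]]
  · filter_upwards [hfin] with ω h1
    by_cases hne : ω ∈ nonemptyEvent X A
    · have hg := fun i => gridTailFactor_mem_Icc α ‖X i ω‖ hs n (J n ω)
      rw [hUeq h1 hne, norm_mul, Real.norm_eq_abs, Real.norm_eq_abs, abs_of_nonneg
        (Finset.prod_nonneg fun i _ => (hg i).1)]
      exact (mul_le_of_le_one_right (abs_nonneg _)
        (Finset.prod_le_one (fun i _ => (hg i).1) fun i _ => (hg i).2)).trans (hC _)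
    · rw [hU]
      simp only
      rw [Finset.sum_eq_zero fun j hj => by rw [hPempty hne _ n j hj, mul_zero]]
      simpa using hC0
  · filter_upwards [hfin] with ω h1
    by_cases hne : ω ∈ nonemptyEvent X A
    · simp only [hUeq h1 hne, indicator_of_mem hne, tailProduct_eq h1]
      exact (hflim ω).mul (tendsto_finsetProd _ fun i _ =>
        tendsto_gridTailFactor α hs (servingDistance_nonneg X A ω))
    · rw [indicator_of_notMem hne]
      refine tendsto_const_nhds.congr fun n => ?_
      simp only [hU]
      rw [Finset.sum_eq_zero fun j hj => by rw [hPempty hne _ n j hj, mul_zero]]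

end Poisson

end SingleCluster

/-! ### The conditional distribution given the serving distance -/

namespace SingleCluster

open Filter Topology

/-- Two functions with values in `[0, 1]` agree almost everywhere if their integrals against all
bounded continuous functions agree. -/
theorem ae_eq_of_forall_integral_continuous_mul_eq {ν : Measure ℝ} [IsFiniteMeasure ν]
    {k l : ℝ → ℝ} (hk : Measurable k) (hl : Measurable l) (hk1 : ∀ r, k r ∈ Icc (0 : ℝ) 1)
    (hl1 : ∀ r, l r ∈ Icc (0 : ℝ) 1)
    (h : ∀ f : ℝ → ℝ, Continuous f → (∃ C, ∀ x, |f x| ≤ C) →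
      ∫ r, f r * k r ∂ν = ∫ r, f r * l r ∂ν) : k =ᵐ[ν] l := by
  have hfinite : ∀ {g : ℝ → ℝ}, (∀ r, g r ∈ Icc (0 : ℝ) 1) →
      IsFiniteMeasure (ν.withDensity fun r => ENNReal.ofReal (g r)) := fun {g} hg =>
    isFiniteMeasure_withDensity (ne_top_of_le_ne_top (measure_ne_top ν univ) (by
      calc ∫⁻ r, ENNReal.ofReal (g r) ∂ν ≤ ∫⁻ _, 1 ∂ν :=
            lintegral_mono fun r => ENNReal.ofReal_le_one.2 (hg r).2
        _ = ν univ := by simp))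
  have hint : ∀ {g : ℝ → ℝ}, Measurable g → (∀ r, g r ∈ Icc (0 : ℝ) 1) → ∀ f : ℝ → ℝ,
      ∫ r, f r ∂(ν.withDensity fun r => ENNReal.ofReal (g r)) = ∫ r, f r * g r ∂ν := by
    intro g hgm hg f
    rw [integral_withDensity_eq_integral_toReal_smul hgm.ennreal_ofReal
      (Eventually.of_forall fun r => ENNReal.ofReal_lt_top)]
    refine integral_congr_ae (Eventually.of_forall fun r => ?_)
    simp only [ENNReal.toReal_ofReal (hg r).1, smul_eq_mul, mul_comm]
  have := hfinite hk1
  have := hfinite hl1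
  -- Finite measures on `ℝ` are determined by bounded continuous functions, and densities are
  -- determined almost everywhere.
  have heq : (ν.withDensity fun r => ENNReal.ofReal (k r)) =
      ν.withDensity fun r => ENNReal.ofReal (l r) := by
    refine ext_of_forall_integral_eq_of_IsFiniteMeasure fun f => ?_
    rw [hint hk hk1, hint hl hl1]
    exact h f f.continuous ⟨‖f‖, fun x => f.norm_coe_le_norm x⟩
  have h2 := (withDensity_eq_iff_of_sigmaFinite hk.ennreal_ofReal.aemeasurable
    hl.ennreal_ofReal.aemeasurable).1 heq
  filter_upwards [h2] with r hr
  exact (ENNReal.ofReal_eq_ofReal_iff (hk1 r).1 (hl1 r).1).1 hr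

section OuterIntegral

variable {A : Set Plane} {M : ℝ}

theorem outerIntegral_nonneg (α : ℝ) {s : ℝ} (hs : 0 < s) (hA : MeasurableSet A) (r : ℝ) :
    0 ≤ outerIntegral α s A r := by
  rw [outerIntegral_eq α s r hA]
  refine integral_nonneg fun y => ?_
  have := (tailFactor_mem_Icc α r hs (norm_nonneg y)).2
  simp only [Pi.zero_apply]
  linarith

theorem measurable_outerIntegral (α s : ℝ) (hA : MeasurableSet A) :
    Measurable (outerIntegral α s A) := by
  have h1 : Measurable fun p : ℝ × Plane => 1 - tailFactor α s p.1 ‖p.2‖ := by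
    refine measurable_const.sub (Measurable.ite ?_ ?_ measurable_const)
    · exact measurableSet_lt measurable_fst measurable_snd.norm
    · exact (measurable_fadingFactor α s).comp measurable_snd.norm
  have h2 := (h1.stronglyMeasurable.integral_prod_right' (ν := volume.restrict A)).measurable
  convert h2 using 1
  ext r
  exact outerIntegral_eq α s r hA

/-- Writing `s = exp t` turns `s > 0` into all of `ℝ`, where the rationals are dense. -/
theorem continuous_outerIntegral_exp (α r : ℝ) (hA : MeasurableSet A) (hM : ∀ y ∈ A, ‖y‖ ≤ M) :
    Continuous fun t => outerIntegral α (Real.exp t) A r := by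
  simp only [outerIntegral_eq α _ r hA]
  refine continuous_of_dominated (bound := fun _ => 1) (fun t => ?_) (fun t => ?_)
    (integrableOn_of_mem_Icc hM measurable_const fun _ => by simp) ?_
  · exact (measurable_const.sub
      ((measurable_tailFactor α (Real.exp t) r).comp measurable_norm)).aestronglyMeasurable
  · refine Eventually.of_forall fun y => ?_
    have := tailFactor_mem_Icc α r (Real.exp_pos t) (norm_nonneg y)
    rw [Real.norm_of_nonneg (by linarith [this.2])]
    linarith [this.1]
  · refine Eventually.of_forall fun y => continuous_const.sub ?_
    simp only [tailFactor, fadingFactor]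
    split_ifs
    · refine (continuous_const.add (Real.continuous_exp.mul continuous_const)).inv₀ fun t => ?_
      exact (add_pos_of_pos_of_nonneg one_pos
        (mul_nonneg (Real.exp_pos t).le (Real.rpow_nonneg (norm_nonneg y) (-α)))).ne'
    · exact continuous_const

end OuterIntegral

theorem continuous_integral_exp_exp (κ : Measure ℝ) [IsFiniteMeasure κ] :
    Continuous fun t => ∫ x, Real.exp (-Real.exp t * max x 0) ∂κ := by
  refine continuous_of_dominated (bound := fun _ => 1) (fun t => ?_) (fun t => ?_)
    (integrable_const 1) ?_
  · exact (by fun_prop : Measurable _).aestronglyMeasurable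
  · refine Eventually.of_forall fun x => ?_
    rw [Real.norm_eq_abs, Real.abs_exp, Real.exp_le_one_iff, neg_mul, neg_nonpos]
    exact mul_nonneg (Real.exp_pos t).le (le_max_right _ _)
  · exact Eventually.of_forall fun x => by fun_prop

section Conditional

variable {Ω : Type*} [MeasurableSpace Ω] {μ : Measure Ω} {lam : ℝ}
  {X : ℕ → Ω → Plane} {h : ℕ → Ω → ℝ} {A : Set Plane} {M : ℝ}

/-- Nonnegativity of the interference is a null-set statement about the joint law, disintegrated
along the serving distance; it allows the clamp to be removed for all `s` at once. -/
theorem ae_condDistrib_nonneg (α : ℝ) (hX : IsHPPP lam X μ) (hh : IsRayleighFading X h μ)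
    (hA : MeasurableSet A) (hM : ∀ y ∈ A, ‖y‖ ≤ M) :
    ∀ᵐ r ∂((conditionedLaw μ X A).map (servingDistance X A)),
      ∀ᵐ x ∂(condDistrib (interference α X h A) (servingDistance X A) (conditionedLaw μ X A) r),
        0 ≤ x := by
  have hR := measurable_servingDistance hX.measurable hA
  have hI : AEMeasurable (interference α X h A) (conditionedLaw μ X A) :=
    (aemeasurable_interference α hX hh hA hM).mono_ac (cond_absolutelyContinuous)
  refine Measure.ae_ae_of_ae_compProd (p := fun p => 0 ≤ p.2) ?_
  rw [compProd_map_condDistrib hI, ae_map_iff (hR.aemeasurable.prodMk hI)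
    (measurableSet_le measurable_const measurable_snd)]
  filter_upwards [cond_absolutelyContinuous.ae_le hh.ae_nonneg] with ω hω
  exact interference_nonneg α hω

/-- Both sides are functions of `r` valued in `[0, 1]`, so it suffices to test them against bounded
continuous `f`; the disintegration of the joint law turns this into an identity of expectations. -/
theorem ae_integral_condDistrib_eq [IsProbabilityMeasure μ] (α : ℝ) {s : ℝ} (hs : 0 < s) (hlam : 0 ≤ lam)
    (hX : IsHPPP lam X μ) (hh : IsRayleighFading X h μ) (hA : MeasurableSet A) (hM0 : 0 ≤ M)
    (hM : ∀ y ∈ A, ‖y‖ ≤ M) :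
    ∀ᵐ r ∂((conditionedLaw μ X A).map (servingDistance X A)),
      ∫ x, Real.exp (-s * max x 0)
        ∂(condDistrib (interference α X h A) (servingDistance X A) (conditionedLaw μ X A) r) =
      Real.exp (-(lam * outerIntegral α s A r)) := by
  have hR := measurable_servingDistance hX.measurable hA
  have hI : AEMeasurable (interference α X h A) (conditionedLaw μ X A) :=
    (aemeasurable_interference α hX hh hA hM).mono_ac (cond_absolutelyContinuous)
  set κ := condDistrib (interference α X h A) (servingDistance X A) (conditionedLaw μ X A)
  have hexp : ∀ x : ℝ, Real.exp (-s * max x 0) ∈ Icc (0 : ℝ) 1 := fun x => by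
    refine ⟨(Real.exp_pos _).le, ?_⟩
    rw [Real.exp_le_one_iff, neg_mul, neg_nonpos]
    exact mul_nonneg hs.le (le_max_right _ _)
  have hem : Measurable fun x : ℝ => Real.exp (-s * max x 0) := by fun_prop
  refine ae_eq_of_forall_integral_continuous_mul_eq ?_
    ((measurable_outerIntegral α s hA).const_mul lam).neg.exp (fun r => ?_) (fun r => ?_) ?_
  · exact (hem.stronglyMeasurable.integral_kernel (κ := κ)).measurable
  · refine ⟨integral_nonneg fun x => (hexp x).1, ?_⟩
    calc ∫ x, Real.exp (-s * max x 0) ∂(κ r) ≤ ∫ _, (1 : ℝ) ∂(κ r) :=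
          integral_mono_of_nonneg (Eventually.of_forall fun x => (hexp x).1)
            (integrable_const 1) (Eventually.of_forall fun x => (hexp x).2)
      _ = 1 := by simp
  · refine ⟨(Real.exp_pos _).le, ?_⟩
    rw [Real.exp_le_one_iff, neg_nonpos]
    exact mul_nonneg hlam (outerIntegral_nonneg α hs hA r)
  · rintro f hf ⟨C, hC⟩
    have hFm : Measurable fun p : ℝ × ℝ => f p.1 * Real.exp (-s * max p.2 0) :=
      (hf.measurable.comp measurable_fst).mul (hem.comp measurable_snd)
    have e1 : ∫ r, f r * ∫ x, Real.exp (-s * max x 0) ∂(κ r)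
        ∂((conditionedLaw μ X A).map (servingDistance X A)) =
        ∫ ω, f (servingDistance X A ω) * Real.exp (-s * max (interference α X h A ω) 0)
          ∂(conditionedLaw μ X A) := by
      have e := integral_map (hR.aemeasurable.prodMk hI) hFm.aestronglyMeasurable
      rw [← e, ← compProd_map_condDistrib hI, Measure.integral_compProd]
      · simp only [integral_const_mul]
        rfl
      · refine Integrable.of_bound hFm.aestronglyMeasurable C (Eventually.of_forall fun p => ?_)
        rw [norm_mul, Real.norm_eq_abs, Real.norm_eq_abs, abs_of_nonneg (hexp p.2).1]
        exact (mul_le_of_le_one_right (abs_nonneg _) (hexp p.2).2).trans (hC _)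
    have e2 : ∫ ω, f (servingDistance X A ω) * Real.exp (-s * max (interference α X h A ω) 0)
          ∂(conditionedLaw μ X A) =
        ∫ ω, f (servingDistance X A ω) * Real.exp (-s * interference α X h A ω)
          ∂(conditionedLaw μ X A) := by
      refine integral_congr_ae ?_
      filter_upwards [cond_absolutelyContinuous.ae_le hh.ae_nonneg] with ω hω
      rw [max_eq_left (interference_nonneg α hω)]
    have e3 : ∫ r, f r * Real.exp (-(lam * outerIntegral α s A r))
        ∂((conditionedLaw μ X A).map (servingDistance X A)) =
        ∫ ω, f (servingDistance X A ω) *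
          Real.exp (-(lam * outerIntegral α s A (servingDistance X A ω)))
          ∂(conditionedLaw μ X A) :=
      integral_map hR.aemeasurable (hf.measurable.mul
        ((measurable_outerIntegral α s hA).const_mul lam).neg.exp).aestronglyMeasurable
    -- The conditioned law is a multiple of the restriction to the nonempty event, with the same
    -- constant on both sides.
    rw [e1, e2, e3, conditionedLaw, ProbabilityTheory.cond, integral_smul_measure,
      integral_smul_measure, setIntegral_exp_interference α hs hlam hX hh hA hM0 hM hf hC,
      setIntegral_tailProduct α hs hlam hX hA hM hf hC]

/-- The conditional Laplace transform of the interference for a bounded region `A`. -/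
theorem ae_forall_integral_condDistrib_eq [IsProbabilityMeasure μ] (α : ℝ) (hlam : 0 ≤ lam)
    (hX : IsHPPP lam X μ) (hh : IsRayleighFading X h μ) (hA : MeasurableSet A) (hM0 : 0 ≤ M)
    (hM : ∀ y ∈ A, ‖y‖ ≤ M) :
    ∀ᵐ r ∂((conditionedLaw μ X A).map (servingDistance X A)), ∀ s : ℝ, 0 < s →
      Integrable (fun x => Real.exp (-s * x))
        (condDistrib (interference α X h A) (servingDistance X A) (conditionedLaw μ X A) r) ∧
      ∫ x, Real.exp (-s * x)
        ∂(condDistrib (interference α X h A) (servingDistance X A) (conditionedLaw μ X A) r) =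
      Real.exp (-(lam * outerIntegral α s A r)) := by
  have hq : ∀ᵐ r ∂((conditionedLaw μ X A).map (servingDistance X A)), ∀ q : ℚ,
      ∫ x, Real.exp (-Real.exp (q : ℝ) * max x 0)
        ∂(condDistrib (interference α X h A) (servingDistance X A) (conditionedLaw μ X A) r) =
      Real.exp (-(lam * outerIntegral α (Real.exp q) A r)) :=
    ae_all_iff.2 fun q =>
      ae_integral_condDistrib_eq α (Real.exp_pos _) hlam hX hh hA hM0 hM
  filter_upwards [hq, ae_condDistrib_nonneg α hX hh hA hM] with r h1 h2 s hs
  set κ := condDistrib (interference α X h A) (servingDistance X A) (conditionedLaw μ X A)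
  have hae : (fun x => Real.exp (-s * max x 0)) =ᵐ[κ r] fun x => Real.exp (-s * x) := by
    filter_upwards [h2] with x hx
    rw [max_eq_left hx]
  constructor
  · refine Integrable.congr (Integrable.of_bound
      (by fun_prop : Measurable _).aestronglyMeasurable 1 (Eventually.of_forall fun x => ?_)) hae
    rw [Real.norm_eq_abs, Real.abs_exp, Real.exp_le_one_iff, neg_mul, neg_nonpos]
    exact mul_nonneg hs.le (le_max_right _ _)
  -- Two continuous functions of `t` agreeing at all rationals agree at `t = log s`; the exceptional
  -- set of `r` was fixed before `s`.
  · have heq := Rat.denseRange_cast (𝕜 := ℝ) |>.equalizer (continuous_integral_exp_exp (κ r))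
      (Real.continuous_exp.comp ((continuous_outerIntegral_exp α r hA hM).const_mul lam).neg)
      (funext h1)
    have h3 := congrFun heq (Real.log s)
    simp only [Function.comp_apply, Pi.neg_apply, Real.exp_log hs] at h3
    rw [← integral_congr_ae hae, h3]

/-- The strict bounds come from the origin and the sphere of radius `‖xo‖ + D` being null sets. They
are needed because the formulas divide by `r` and the cases exclude the right endpoint. -/
theorem ae_servingDistance_mem (hX : IsHPPP lam X μ) (xo : Plane) (D : ℝ) :
    ∀ᵐ r ∂((conditionedLaw μ X (Metric.closedBall xo D)).map
      (servingDistance X (Metric.closedBall xo D))), 0 < r ∧ ‖xo‖ - D ≤ r ∧ r < ‖xo‖ + D := by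
  have hA : MeasurableSet (Metric.closedBall xo D) := measurableSet_closedBall
  have hR := measurable_servingDistance hX.measurable hA
  refine (ae_map_iff hR.aemeasurable (measurableSet_Ioi.inter
    (measurableSet_Ici.inter measurableSet_Iio))).2 ?_
  have h0 := hX.ae_notMem_of_volume_eq_zero (measurableSet_singleton 0)
    Bornology.isBounded_singleton (measure_singleton 0)
  -- No sign is imposed on `D`, so radius `0` is set apart; it is excluded at the end by the
  -- positivity of the serving distance.
  have h1 : ∀ᵐ ω ∂μ, ‖xo‖ + D = 0 ∨ ∀ i, X i ω ∉ Metric.sphere (0 : Plane) (‖xo‖ + D) := by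
    by_cases h : ‖xo‖ + D = 0
    · exact Eventually.of_forall fun _ => Or.inl h
    · filter_upwards [hX.ae_notMem_of_volume_eq_zero Metric.isClosed_sphere.measurableSet
        Metric.isBounded_sphere (Measure.addHaar_sphere_of_ne_zero volume 0 h)] with ω hω
      exact Or.inr hω
  have hfin := hX.ae_finite hA Metric.isBounded_closedBall
  filter_upwards [cond_absolutelyContinuous.ae_le h0, cond_absolutelyContinuous.ae_le h1,
    cond_absolutelyContinuous.ae_le hfin,
    ae_cond_mem (measurableSet_nonemptyEvent hX.measurable hA)] with ω h0 h1 h2 h3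
  have hc := (servingIndex_spec h2 h3).1
  set i := servingIndex X (Metric.closedBall xo D) ω
  rw [mem_closedBall_iff_norm] at hc
  have hpos : 0 < ‖X i ω‖ := norm_pos_iff.2 fun h => h0 i (by simp [h])
  have hle : ‖X i ω‖ ≤ ‖xo‖ + D := by
    have := norm_le_norm_add_norm_sub' (X i ω) xo
    linarith
  refine ⟨hpos, ?_, lt_of_le_of_ne hle fun h => ?_⟩
  · have := norm_le_norm_add_norm_sub' xo (X i ω)
    rw [norm_sub_rev] at this
    change ‖xo‖ - D ≤ ‖X i ω‖
    linarith
  · rcases h1 with h1 | h1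
    · exact hpos.ne' (h.trans h1)
    · exact h1 i (by simpa using h)

end Conditional

end SingleCluster

/-- Conditioned on the serving distance, the Laplace transform of the interference under the
closest-selection strategy, for a Poisson process of transmitters on a disk. -/
theorem theorem1 {Ω : Type*} [MeasurableSpace Ω] (μ : Measure Ω) [IsProbabilityMeasure μ]
    (lam α D d : ℝ) (hlam : 0 < lam) (hα : 2 < α) (hD : 0 < D)
    (xo : SingleCluster.Plane) (hd : d = ‖xo‖)
    (X : ℕ → Ω → SingleCluster.Plane) (h : ℕ → Ω → ℝ)
    (hX : SingleCluster.IsHPPP lam X μ) (hh : SingleCluster.IsRayleighFading X h μ)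
    (A : Set SingleCluster.Plane) (hA : A = Metric.closedBall xo D) :
    Measurable (SingleCluster.servingDistance X A) ∧
    AEMeasurable (SingleCluster.interference α X h A) (SingleCluster.conditionedLaw μ X A) ∧
    ∀ᵐ r ∂((SingleCluster.conditionedLaw μ X A).map (SingleCluster.servingDistance X A)),
      ∀ s : ℝ, 0 < s →
        Integrable (fun x => Real.exp (-s * x))
          (condDistrib (SingleCluster.interference α X h A) (SingleCluster.servingDistance X A)
            (SingleCluster.conditionedLaw μ X A) r) ∧
        ∫ x, Real.exp (-s * x)
          ∂(condDistrib (SingleCluster.interference α X h A) (SingleCluster.servingDistance X A)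
            (SingleCluster.conditionedLaw μ X A) r) =
        SingleCluster.ltClosest lam α D d s r := by
  subst hA hd
  have hA : MeasurableSet (Metric.closedBall xo D) := measurableSet_closedBall
  have hM : ∀ y ∈ Metric.closedBall xo D, ‖y‖ ≤ ‖xo‖ + D := fun y hy => by
    rw [mem_closedBall_iff_norm] at hy
    linarith [norm_le_norm_add_norm_sub' y xo]
  have hM0 : 0 ≤ ‖xo‖ + D := by positivity
  refine ⟨SingleCluster.measurable_servingDistance hX.measurable hA,
    (SingleCluster.aemeasurable_interference α hX hh hA hM).mono_ac cond_absolutelyContinuous, ?_⟩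
  filter_upwards [SingleCluster.ae_forall_integral_condDistrib_eq α hlam.le hX hh hA hM0 hM,
    SingleCluster.ae_servingDistance_mem hX xo D] with r h1 h2 s hs
  rw [SingleCluster.ltClosest_eq hα hs hD xo h2.1 h2.2.1 h2.2.2]
  exact h1 s hs
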